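/- All graphs are finite, simple and have at least one vertex; $d(v)$ is the degree of $v$ and $N(v)$ its set of neighbours. A \emph{dynamic $k$-coloring} of $G$ is a surjective map $c:V(G)\to\{1,\dots,k\}$ such that $c(u)\ne c(v)$ for adjacent $u,v$, and $|c(N(v))|\ge\min\{d(v),2\}$ for every vertex $v$. $G$ is \emph{dynamically 3-colorable} if it has a dynamic $k$-coloring for some $1\le k\le 3$. For $i \ge 2$, an $A_i$ in $G$ is a path with $i$ vertices whose two end-vertices have degree 3 in $G$ and whose internal vertices have degree 2 in $G$. Let $\mathscr{C}$ be the class of graphs of maximum degree at most 3 that are claw-free (no induced $K_{1,3}$) and contain no $A_{3j+1}$ for any integer $j\ge1$. Let $\mathscr{E}$ be the class of graphs isomorphic to a graph obtained from $K_4$ by replacing one edge by a path $P_i$ on $i$ vertices (the ends of the edge being the ends of the path), where $i=3j$ or $i=3j-1$ for some integer $j\ge1$. The machine model is a unit-cost random access machine whose only arithmetic operations are successor and predecessor. The input is a graph on the vertices $0,\dots,n-1$ given by its number $n$ of vertices and its adjacency lists, in arbitrary order, stored one after another in an array together with an array of their starting positions. (1) There is an algorithm that decides in $O(n)$ time whether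 a given graph belongs to $\mathscr{C}$. (2) There is an algorithm that decides in $O(n)$ time whether a given connected graph in $\mathscr{C}$ is dynamically 3-colorable. (3) The following determination procedure can be carried out in $O(n)$ time on connected graphs $G$ in $\mathscr{C}$: if $G$ has a vertex of degree 1, answer "yes"; otherwise, if the number of vertices of degree 3 is not 4, answer "yes"; otherwise, answer "no" if $G\in\mathscr{E}$ and "yes" if $G\notin\mathscr{E}$. (4) For every connected graph $G$ in $\mathscr{C}$ that is not a cycle (that is, not all vertices have degree 2), the procedure in (3) answers "yes" if and only if $G$ is dynamically 3-colorable. -/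

import Mathlib

namespace DynCol

/-! ### Graph notions -/

section Graphs

variable {V : Type*} (G : SimpleGraph V)

/-- The degree `d(v) = |N_G(v)|`. It is only used for finite graphs. -/
noncomputable def deg (v : V) : ℕ := (G.neighborSet v).ncard

/-- `c` is a proper dynamic `k`-coloring: a surjective map to `k` colors such that adjacent
vertices get different colors and `|c(N_G(v))| ≥ min {d(v), 2}` for every vertex `v`. -/
def IsDynamicColoring (k : ℕ) (c : V → Fin k) : Prop :=
  Function.Surjective c ∧
  (∀ u v, G.Adj u v → c u ≠ c v) ∧
  ∀ v, min (deg G v) 2 ≤ (c '' G.neighborSet v).ncard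

/-- `G` is dynamically 3-colorable: the least `k > 0` for which there is a proper dynamic
`k`-coloring of `G` is at most `3`. -/
def DynThreeColorable : Prop :=
  ∃ k : ℕ, 0 < k ∧ k ≤ 3 ∧ ∃ c : V → Fin k, IsDynamicColoring G k c

/-- No induced `K_{1,3}`. -/
def ClawFree : Prop :=
  ∀ v x y z, G.Adj v x → G.Adj v y → G.Adj v z → x ≠ y → y ≠ z → x ≠ z →
    G.Adj x y ∨ G.Adj y z ∨ G.Adj x z

/-- `G` contains an `A_i`: a path with `i` vertices whose two ends have degree 3 in `G` and whose
internal vertices have degree 2 in `G`. -/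
def HasA (i : ℕ) : Prop :=
  ∃ (u v : V) (p : G.Walk u v), p.IsPath ∧ p.length + 1 = i ∧ deg G u = 3 ∧ deg G v = 3 ∧
    ∀ w ∈ p.support, w ≠ u → w ≠ v → deg G w = 2

/-- The class `𝒞`: maximum degree at most 3, claw-free, and `A_i`-free for all
`i = 3j + 1`, `j ≥ 1`. (Connectedness is stated separately where it is needed.) -/
def InC : Prop :=
  (∀ v, deg G v ≤ 3) ∧ ClawFree G ∧ ∀ j : ℕ, 1 ≤ j → ¬ HasA G (3 * j + 1)

/-- `K₄` with one edge replaced by a path `P_i` on `i` vertices (`i ≥ 2`): the path is `Fin i`, its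
ends `0` and `i - 1` are the ends of the replaced edge, and `Fin 2` are the two other vertices
of `K₄`. (`fromRel` symmetrizes and removes loops.) -/
def k4Path (i : ℕ) : SimpleGraph (Fin i ⊕ Fin 2) :=
  SimpleGraph.fromRel fun x y =>
    match x, y with
    | .inl a, .inl b => a.val + 1 = b.val
    | .inl a, .inr _ => a.val = 0 ∨ a.val + 1 = i
    | .inr _, .inl _ => False
    | .inr _, .inr _ => True

/-- The exceptional class `ℰ`: the graphs obtained from `K₄` by replacing one edge by a `P_i`,
where `i = 3j` or `i = 3j - 1` with `j ≥ 1`. -/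
def InE : Prop :=
  ∃ i j : ℕ, 1 ≤ j ∧ (i = 3 * j ∨ i = 3 * j - 1) ∧ Nonempty (G ≃g k4Path i)

/-- The determination algorithm answers "dynamically 3-colorable": there is a vertex of degree 1,
or else the number of vertices of degree 3 is not 4, or else the graph is not in `ℰ`. -/
def DeterminationAnswer : Prop :=
  (∃ v, deg G v = 1) ∨ {v | deg G v = 3}.ncard ≠ 4 ∨ ¬ InE G

end Graphs

/-! ### Machine model

A random access machine with unit cost, programmed by structured programs. Its memory consists of
registers and arrays of natural numbers. The only arithmetic is successor and predecessor, so
after `t` steps no value exceeds `t` plus the largest number in the input and the program: unit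
cost cannot be exploited by building long numbers. -/

/-- Memory: registers `reg r` and array cells `arr a i`. -/
structure Mem where
  reg : ℕ → ℕ
  arr : ℕ → ℕ → ℕ

/-- Write `k` to register `x`. -/
def Mem.setReg (s : Mem) (x k : ℕ) : Mem :=
  { s with reg := Function.update s.reg x k }

/-- Write `k` to cell `i` of array `a`. -/
def Mem.setArr (s : Mem) (a i k : ℕ) : Mem :=
  { s with arr := Function.update s.arr a (Function.update (s.arr a) i k) }

/-- Comparisons of two registers. -/
inductive Test where
  | eq (x y : ℕ)
  | lt (x y : ℕ)

def Test.Holds : Test → Mem → Prop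
  | .eq x y, s => s.reg x = s.reg y
  | .lt x y, s => s.reg x < s.reg y

/-- Programs. All letters `x`, `y` are register names, `a` is an array name. -/
inductive Prog where
  /-- `x := k` for a fixed number `k` -/
  | const (x k : ℕ)
  /-- `x := y` -/
  | copy (x y : ℕ)
  /-- `x := y + 1` -/
  | succ (x y : ℕ)
  /-- `x := y - 1`, where `0 - 1 = 0` -/
  | pred (x y : ℕ)
  /-- `x := a[y]` -/
  | load (x a y : ℕ)
  /-- `a[x] := y` -/
  | store (a x y : ℕ)
  | seq (P Q : Prog)
  | ite (b : Test) (P Q : Prog)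
  | loop (b : Test) (P : Prog)

/-- `Runs P s t s'`: started in memory `s`, the program `P` halts after exactly `t` steps, in
memory `s'`. Every assignment and every evaluation of a test is one step;
`loop b P` is "while `b` do `P`". -/
inductive Runs : Prog → Mem → ℕ → Mem → Prop where
  | const (s : Mem) (x k : ℕ) : Runs (.const x k) s 1 (s.setReg x k)
  | copy (s : Mem) (x y : ℕ) : Runs (.copy x y) s 1 (s.setReg x (s.reg y))
  | succ (s : Mem) (x y : ℕ) : Runs (.succ x y) s 1 (s.setReg x (s.reg y + 1))
  | pred (s : Mem) (x y : ℕ) : Runs (.pred x y) s 1 (s.setReg x (s.reg y - 1))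
  | load (s : Mem) (x a y : ℕ) : Runs (.load x a y) s 1 (s.setReg x (s.arr a (s.reg y)))
  | store (s : Mem) (a x y : ℕ) : Runs (.store a x y) s 1 (s.setArr a (s.reg x) (s.reg y))
  | seq {P Q : Prog} {s s' s'' : Mem} {t t' : ℕ} :
      Runs P s t s' → Runs Q s' t' s'' → Runs (.seq P Q) s (t + t') s''
  | ite_true {b : Test} {P Q : Prog} {s s' : Mem} {t : ℕ} :
      b.Holds s → Runs P s t s' → Runs (.ite b P Q) s (t + 1) s'
  | ite_false {b : Test} {P Q : Prog} {s s' : Mem} {t : ℕ} :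
      ¬ b.Holds s → Runs Q s t s' → Runs (.ite b P Q) s (t + 1) s'
  | loop_false {b : Test} {P : Prog} {s : Mem} :
      ¬ b.Holds s → Runs (.loop b P) s 1 s
  | loop_true {b : Test} {P : Prog} {s s' s'' : Mem} {t t' : ℕ} :
      b.Holds s → Runs P s t s' → Runs (.loop b P) s' t' s'' →
      Runs (.loop b P) s (t + t' + 1) s''

/-- `adj` gives adjacency lists of `G`, each in an arbitrary order and without repetitions. -/
def IsAdjLists {n : ℕ} (G : SimpleGraph (Fin n)) (adj : Fin n → List (Fin n)) : Prop :=
  ∀ v, (adj v).Nodup ∧ ∀ u, u ∈ adj v ↔ G.Adj v u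

/-- The memory at the start. Register 0 holds the number `n` of vertices, array 1 holds the
concatenated adjacency lists of the vertices `0, …, n - 1`, and cell `v ≤ n` of array 0 holds the
position in array 1 at which the list of `v` starts (for `v = n`, the total length).
Everything else is 0. -/
def initialMem {n : ℕ} (adj : Fin n → List (Fin n)) : Mem where
  reg r := if r = 0 then n else 0
  arr a i :=
    if a = 0 then (if i ≤ n then ((List.ofFn adj).take i).flatten.length else 0)
    else if a = 1 then ((List.ofFn adj).flatten.map Fin.val).getD i 0
    else 0

/-- On every graph with `n ≥ 1` vertices that satisfies `inputs`, given by any adjacency lists,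
`P` halts after `O(n)` steps, and register 0 then holds 1 if the graph satisfies `property`
and 0 if it does not. -/
def DecidesInLinearTime (P : Prog)
    (inputs property : (n : ℕ) → SimpleGraph (Fin n) → Prop) : Prop :=
  ∃ C : ℕ, ∀ n : ℕ, 0 < n → ∀ (G : SimpleGraph (Fin n)) (adj : Fin n → List (Fin n)),
    IsAdjLists G adj → inputs n G →
    ∃ (t : ℕ) (s : Mem), Runs P (initialMem adj) t s ∧ t ≤ C * n ∧
      (property n G → s.reg 0 = 1) ∧ (¬ property n G → s.reg 0 = 0)

end DynCol

/-!
In a connected graph that is not a cycle, the vertices of degree 2 lie on threads between vertices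
of other degrees. Three consecutive vertices of a thread get three different colors in a dynamic
3-coloring, so the colors along it form an arithmetic progression in `ZMod 3`. Join two vertices of
degree 3 if they are the ends of a thread; this core is again claw-free of maximum degree at most 3.
Since no `A_{3j+1}` occurs, the length of a thread between distinct vertices of degree 3 is not
divisible by 3, and so every proper 3-coloring of the core extends to the graph. By Brooks' theorem
there is one unless the core contains `K₄`. In that case claw-freeness leaves at most one edge of
the `K₄` subdivided, and the graph is in `ℰ`; conversely, a coloring of a graph in `ℰ` would give
the ends of the subdivided edge the same color, since both are adjacent to the other two vertices
of the `K₄`, but different colors by their distance along the thread.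

A cycle is dynamically 3-colorable if and only if 3 divides its length. Every thread is walked once
from each end, which takes linear time in all because the degrees are bounded.
-/

namespace DynCol

section Degree

variable {V : Type*} {G : SimpleGraph V} {v : V}

lemma exists_nbrs_of_deg_three (hd : deg G v = 3) :
    ∃ a b c, a ≠ b ∧ a ≠ c ∧ b ≠ c ∧ G.Adj v a ∧ G.Adj v b ∧ G.Adj v c ∧
      ∀ w, G.Adj v w → w = a ∨ w = b ∨ w = c := by
  obtain ⟨a, b, c, hab, hac, hbc, hN⟩ := Set.ncard_eq_three.1 hd
  have hadj : ∀ w, G.Adj v w ↔ w = a ∨ w = b ∨ w = c := fun w => by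
    rw [← SimpleGraph.mem_neighborSet, hN]; rfl
  exact ⟨a, b, c, hab, hac, hbc, by simp [hadj], by simp [hadj], by simp [hadj],
    fun w => (hadj w).1⟩

lemma ClawFree.exists_triangle (hcf : ClawFree G) (hd : deg G v = 3) :
    ∃ a b c, c ≠ a ∧ c ≠ b ∧ G.Adj v a ∧ G.Adj v b ∧ G.Adj a b ∧ G.Adj v c ∧
      ∀ w, G.Adj v w → w = a ∨ w = b ∨ w = c := by
  obtain ⟨x, y, z, hxy, hxz, hyz, hx, hy, hz, hN⟩ := exists_nbrs_of_deg_three hd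
  rcases hcf v x y z hx hy hz hxy hyz hxz with h | h | h
  · exact ⟨x, y, z, hxz.symm, hyz.symm, hx, hy, h, hz, hN⟩
  · exact ⟨y, z, x, hxy, hxz, hy, hz, h, hx, fun w hw => by have := hN w hw; tauto⟩
  · exact ⟨x, z, y, hxy.symm, hyz, hx, hz, h, hy, fun w hw => by have := hN w hw; tauto⟩

lemma exists_ne_of_deg_two (hd : deg G v = 2) (a : V) : ∃ b, b ≠ a ∧ G.Adj v b := by
  obtain ⟨b, hb, hba⟩ := Set.exists_ne_of_one_lt_ncard (s := G.neighborSet v)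
    (by rw [← deg, hd]; norm_num) a
  exact ⟨b, hba, hb⟩

lemma deg_eq_three_of_nbrs {a b c : V} (hab : a ≠ b) (hac : a ≠ c) (hbc : b ≠ c)
    (h : ∀ w, G.Adj v w ↔ w = a ∨ w = b ∨ w = c) : deg G v = 3 :=
  Set.ncard_eq_three.2 ⟨a, b, c, hab, hac, hbc, Set.ext fun w => h w⟩

lemma deg_eq_two_of_nbrs {a b : V} (hab : a ≠ b) (h : ∀ w, G.Adj v w ↔ w = a ∨ w = b) :
    deg G v = 2 :=
  Set.ncard_eq_two.2 ⟨a, b, hab, Set.ext fun w => h w⟩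

variable [Finite V]

lemma deg_le_ncard {S : Set V} (h : ∀ w, G.Adj v w → w ∈ S) : deg G v ≤ S.ncard :=
  Set.ncard_le_ncard (fun w hw => h w hw) (Set.toFinite _)

lemma deg_mono {H : SimpleGraph V} (h : H ≤ G) (v : V) : deg H v ≤ deg G v :=
  deg_le_ncard fun _ hw => h hw

lemma mem_of_deg_le_ncard {S : Set V} (hd : deg G v ≤ S.ncard) (hS : ∀ a ∈ S, G.Adj v a) {w : V}
    (hw : G.Adj v w) : w ∈ S := by
  rwa [Set.eq_of_subset_of_ncard_le (t := G.neighborSet v) hS hd (Set.toFinite _)]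

lemma eq_of_deg_le_one {a w : V} (hd : deg G v ≤ 1) (ha : G.Adj v a) (hw : G.Adj v w) : w = a :=
  mem_of_deg_le_ncard (S := {a}) (by simpa using hd) (by simpa using ha) hw

lemma eq_or_eq_of_deg_le_two {a b w : V} (hd : deg G v ≤ 2) (ha : G.Adj v a) (hb : G.Adj v b)
    (hab : a ≠ b) (hw : G.Adj v w) : w = a ∨ w = b :=
  mem_of_deg_le_ncard (S := {a, b}) (by rwa [Set.ncard_pair hab]) (by simp [ha, hb]) hw

lemma eq_of_deg_le_three {a b c w : V} (hd : deg G v ≤ 3) (ha : G.Adj v a) (hb : G.Adj v b)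
    (hc : G.Adj v c) (hab : a ≠ b) (hac : a ≠ c) (hbc : b ≠ c) (hw : G.Adj v w) :
    w = a ∨ w = b ∨ w = c :=
  mem_of_deg_le_ncard (S := {a, b, c})
    (by rwa [Set.ncard_eq_three.2 ⟨a, b, c, hab, hac, hbc, rfl⟩]) (by simp [ha, hb, hc]) hw

lemma exists_third_of_deg_three {a b : V} (hd : deg G v = 3) (ha : G.Adj v a) (hb : G.Adj v b)
    (hab : a ≠ b) : ∃ c, c ≠ a ∧ c ≠ b ∧ G.Adj v c ∧ ∀ w, G.Adj v w → w = a ∨ w = b ∨ w = c := by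
  obtain ⟨c, hc, hcS⟩ := Set.exists_mem_notMem_of_ncard_lt_ncard (s := {a, b})
    (t := G.neighborSet v) (by rw [Set.ncard_pair hab, ← deg, hd]; norm_num)
  obtain ⟨hca, hcb⟩ : c ≠ a ∧ c ≠ b := by simpa using hcS
  exact ⟨c, hca, hcb, hc, fun w =>
    eq_of_deg_le_three hd.le ha hb hc hab hca.symm hcb.symm⟩

lemma deg_pos_iff : 0 < deg G v ↔ ∃ w, G.Adj v w :=
  Set.ncard_pos (Set.toFinite _)

end Degree

section Coloring

variable {V : Type*} {G : SimpleGraph V} {D : Set V}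

/-- The graph obtained from `G` by removing all edges at vertices of `D`. The vertices of `D` are
kept as isolated vertices, so that inductions need not change the vertex type. -/
def isolate (G : SimpleGraph V) (D : Set V) : SimpleGraph V where
  Adj u v := G.Adj u v ∧ u ∉ D ∧ v ∉ D
  symm := ⟨fun _ _ h => ⟨h.1.symm, h.2.2, h.2.1⟩⟩
  loopless := ⟨fun _ h => G.loopless.irrefl _ h.1⟩

lemma isolate_le : isolate G D ≤ G := fun _ _ h => h.1

lemma clawFree_isolate (h : ClawFree G) : ClawFree (isolate G D) := by
  intro v x y z hx hy hz hxy hyz hxz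
  rcases h v x y z hx.1 hy.1 hz.1 hxy hyz hxz with h | h | h
  exacts [.inl ⟨h, hx.2.2, hy.2.2⟩, .inr (.inl ⟨h, hy.2.2, hz.2.2⟩),
    .inr (.inr ⟨h, hx.2.2, hz.2.2⟩)]

lemma support_isolate_subset : (isolate G D).support ⊆ G.support \ D :=
  fun _ ⟨w, h⟩ => ⟨⟨w, h.1⟩, h.2.1⟩

lemma colorable_of_coloring_isolate {n : ℕ} (c : (isolate G D).Coloring (Fin n)) (f : V → Fin n)
    (hoff : ∀ v ∉ D, f v = c v) (hon : ∀ v ∈ D, ∀ w, G.Adj v w → f v ≠ f w) : G.Colorable n := by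
  refine ⟨SimpleGraph.Coloring.mk f fun {u v} huv => ?_⟩
  by_cases hu : u ∈ D
  · exact hon u hu v huv
  by_cases hv : v ∈ D
  · exact (hon v hv u huv.symm).symm
  rw [hoff u hu, hoff v hv]
  exact c.valid ⟨huv, hu, hv⟩

/-- Every edge is in at most one triangle. This excludes `K₄` as well as `K₄` minus an edge. -/
def DiamondFree (G : SimpleGraph V) : Prop :=
  ∀ a b u v, G.Adj a b → G.Adj a u → G.Adj a v → G.Adj b u → G.Adj b v → u = v

lemma DiamondFree.mono {H : SimpleGraph V} (hdf : DiamondFree G) (hle : H ≤ G) : DiamondFree H :=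
  fun a b u v hab hau hav hbu hbv =>
    hdf a b u v (hle hab) (hle hau) (hle hav) (hle hbu) (hle hbv)

lemma exists_triangle_colors : ∀ p q r : Fin 3, p ≠ q →
    ∃ a b c : Fin 3, a ≠ b ∧ a ≠ c ∧ b ≠ c ∧ a ≠ p ∧ b ≠ q ∧ c ≠ r := by decide

lemma exists_diamond_colors : ∀ p q : Fin 3,
    ∃ a b c : Fin 3, a ≠ b ∧ a ≠ c ∧ b ≠ c ∧ a ≠ p ∧ a ≠ q := by decide

lemma colorable_three_of_coloring_isolate_triangle {x y z x' y' z' : V}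
    (hx : ∀ w, G.Adj x w ↔ w = y ∨ w = z ∨ w = x') (hy : ∀ w, G.Adj y w ↔ w = x ∨ w = z ∨ w = y')
    (hz : ∀ w, G.Adj z w ↔ w = x ∨ w = y ∨ w = z') (hx' : x' ∉ ({x, y, z} : Set V))
    (hy' : y' ∉ ({x, y, z} : Set V)) (hz' : z' ∉ ({x, y, z} : Set V))
    (c : (isolate G {x, y, z}).Coloring (Fin 3)) (hc : c x' ≠ c y') : G.Colorable 3 := by
  classical
  obtain ⟨p, q, r, hpq, hpr, hqr, hp, hq, hr⟩ := exists_triangle_colors (c x') (c y') (c z') hc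
  have hxy : x ≠ y := ((hx y).2 (.inl rfl)).ne
  have hxz : x ≠ z := ((hx z).2 (.inr (.inl rfl))).ne
  have hyz : y ≠ z := ((hy z).2 (.inr (.inl rfl))).ne
  refine colorable_of_coloring_isolate c
    (fun w => if w = x then p else if w = y then q else if w = z then r else c w) ?_ ?_
  · grind
  · simp only [Set.mem_insert_iff, Set.mem_singleton_iff, not_or] at hx' hy' hz'
    rintro v (rfl | rfl | rfl) w hw
    · have := (hx w).1 hw; grind
    · have := (hy w).1 hw; grind
    · have := (hz w).1 hw; grind

lemma ClawFree.isClique_neighborSet_isolate (hcf : ClawFree G) {x x' : V}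
    (hxx' : G.Adj x x') (hxD : x ∈ D) (hx : ∀ w, G.Adj x w → w ∈ D ∨ w = x') :
    (isolate G D).IsClique ((isolate G D).neighborSet x') := by
  have hnot : ∀ w, (isolate G D).Adj x' w → ¬ G.Adj x w := fun w hw hxw =>
    (hx w hxw).elim hw.2.2 hw.ne.symm
  intro a ha b hb hab
  rcases hcf x' x a b hxx'.symm ha.1 hb.1 (fun h => ha.2.2 (h ▸ hxD)) hab
    (fun h => hb.2.2 (h ▸ hxD)) with h | h | h
  · exact absurd h (hnot a ha)
  · exact ⟨h, ha.2.2, hb.2.2⟩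
  · exact absurd h (hnot b hb)

lemma support_isolate_sup_edge_ssubset {x x' y y' : V} (hxD : x ∈ D) (hx'D : x' ∉ D)
    (hy'D : y' ∉ D) (hxx' : G.Adj x x') (hyy' : G.Adj y y') :
    (isolate G D ⊔ SimpleGraph.edge x' y').support ⊂ G.support := by
  have hsub : (isolate G D ⊔ SimpleGraph.edge x' y').support ⊆ G.support \ D := by
    rintro u ⟨w, h | h⟩
    · exact support_isolate_subset ⟨w, h⟩
    · obtain ⟨⟨rfl, -⟩ | ⟨rfl, -⟩, -⟩ := (SimpleGraph.edge_adj ..).1 h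
      exacts [⟨⟨x, hxx'.symm⟩, hx'D⟩, ⟨⟨y, hyy'.symm⟩, hy'D⟩]
  exact ⟨hsub.trans Set.sdiff_subset, fun h => (hsub (h ⟨x', hxx'⟩)).2 hxD⟩

lemma adj_of_sup_edge_of_ne {H : SimpleGraph V} {s t u w : V}
    (h : (H ⊔ SimpleGraph.edge s t).Adj u w) (hst : ¬ (u = s ∧ w = t)) (hts : ¬ (u = t ∧ w = s)) :
    H.Adj u w := by
  rw [SimpleGraph.sup_adj, SimpleGraph.edge_adj] at h
  tauto

lemma ClawFree.sup_edge {H : SimpleGraph V} {s t : V} (hcf : ClawFree H)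
    (hs : H.IsClique (H.neighborSet s)) (ht : H.IsClique (H.neighborSet t)) :
    ClawFree (H ⊔ SimpleGraph.edge s t) := by
  intro v x y z hx hy hz hxy hyz hxz
  suffices h : H.Adj x y ∨ H.Adj y z ∨ H.Adj x z by
    simp only [SimpleGraph.sup_adj]
    tauto
  have hclique : ∀ u, H.IsClique (H.neighborSet u) → ∀ a b, H.Adj u a → H.Adj u b → a ≠ b →
      H.Adj a b := fun u hu a b ha hb hab => hu ha hb hab
  rw [SimpleGraph.sup_adj, SimpleGraph.edge_adj] at hx hy hz
  by_cases hvs : v = s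
  · subst hvs
    have := hclique v hs
    grind
  by_cases hvt : v = t
  · subst hvt
    have := hclique v ht
    grind
  have hH : ∀ w, H.Adj v w ∨ (v = s ∧ w = t ∨ v = t ∧ w = s) ∧ v ≠ w → H.Adj v w := by tauto
  exact hcf v x y z (hH x hx) (hH y hy) (hH z hz) hxy hyz hxz

lemma exists_two_others_of_four {S : Finset V} (hS : S.card = 4) {u v : V} (hu : u ∈ S)
    (hv : v ∈ S) (huv : u ≠ v) :
    ∃ a ∈ S, ∃ b ∈ S, a ≠ b ∧ a ≠ u ∧ a ≠ v ∧ b ≠ u ∧ b ≠ v := by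
  classical
  have hcard : 1 < (S \ {u, v}).card := by
    rw [Finset.card_sdiff_of_subset (by grind), hS, Finset.card_pair huv]
    norm_num
  obtain ⟨a, ha, b, hb, hab⟩ := Finset.one_lt_card.1 hcard
  exact ⟨a, by grind, b, by grind, hab, by grind, by grind, by grind, by grind⟩

lemma cliqueFree_four_iff : G.CliqueFree 4 ↔
    ∀ a b c d, G.Adj a b → G.Adj a c → G.Adj a d → G.Adj b c → G.Adj b d → ¬ G.Adj c d := by
  classical
  refine ⟨fun hK4 a b c d hab hac had hbc hbd hcd => ?_, fun h S hS => ?_⟩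
  · exact hK4 {a, b, c, d} ((SimpleGraph.is3Clique_triple_iff.2 ⟨hbc, hbd, hcd⟩).insert
      (by simp [hab, hac, had]))
  · obtain ⟨c, hc, d, hd, hcd⟩ := Finset.one_lt_card.1 (by rw [hS.card_eq]; norm_num : 1 < S.card)
    obtain ⟨a, ha, b, hb, hab, hac, had, hbc, hbd⟩ :=
      exists_two_others_of_four hS.card_eq hc hd hcd
    exact h a b c d (hS.1 ha hb hab) (hS.1 ha hc hac) (hS.1 ha hd had) (hS.1 hb hc hbc)
      (hS.1 hb hd hbd) (hS.1 hc hd hcd)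

lemma DiamondFree.cliqueFree_sup_edge {H : SimpleGraph V} (hH : DiamondFree H) (s t : V) :
    (H ⊔ SimpleGraph.edge s t).CliqueFree 4 := by
  intro S hS
  have hdiamond : ∀ u ∈ S, ∀ v ∈ S, u ≠ v →
      (s ∈ S → t ∈ S → s ∈ ({u, v} : Set V) ∧ t ∈ ({u, v} : Set V)) → False := by
    intro u hu v hv huv hst
    obtain ⟨a, ha, b, hb, hab, hau, hav, hbu, hbv⟩ :=
      exists_two_others_of_four hS.card_eq hu hv huv
    have hadj : ∀ p ∈ S, ∀ q ∈ S, p ≠ q → p ≠ u → p ≠ v → H.Adj p q := fun p hp q hq hpq _ _ =>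
      adj_of_sup_edge_of_ne (hS.isClique hp hq hpq) (by grind) (by grind)
    exact huv (hH a b u v (hadj a ha b hb hab hau hav) (hadj a ha u hu hau hau hav)
      (hadj a ha v hv hav hau hav) (hadj b hb u hu hbu hbu hbv) (hadj b hb v hv hbv hbu hbv))
  obtain ⟨u, hu, v, hv, huv⟩ := Finset.one_lt_card.1 (by rw [hS.card_eq]; norm_num : 1 < S.card)
  by_cases hst : s ∈ S ∧ t ∈ S ∧ s ≠ t
  · exact hdiamond s hst.1 t hst.2.1 hst.2.2 (by simp)
  · by_cases hs : s ∈ S ∧ t ∈ S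
    · obtain rfl : s = t := by tauto
      obtain ⟨w, hw, hws⟩ := Finset.exists_mem_ne (by rw [hS.card_eq]; norm_num : 1 < S.card) s
      exact hdiamond s hs.1 w hw hws.symm (by simp)
    · exact hdiamond u hu v hv huv (by tauto)

variable [Finite V]

lemma deg_isolate_lt {x v : V} (hvx : G.Adj v x) (hxD : x ∈ D) : deg (isolate G D) v < deg G v :=
  Set.ncard_lt_ncard ⟨fun _ hw => hw.1, fun h => (h hvx).2.2 hxD⟩ (Set.toFinite _)

lemma deg_sup_edge_le {H : SimpleGraph V} {s t : V} {d : ℕ} (hd : ∀ v, deg H v ≤ d)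
    (hs : deg H s < d) (ht : deg H t < d) (v : V) : deg (H ⊔ SimpleGraph.edge s t) v ≤ d := by
  have hinsert : ∀ u u', deg H u < d → (∀ w, (H ⊔ SimpleGraph.edge s t).Adj u w →
      w = u' ∨ H.Adj u w) → deg (H ⊔ SimpleGraph.edge s t) u ≤ d := fun u u' hu h =>
    (deg_le_ncard (S := insert u' (H.neighborSet u)) h).trans
      ((Set.ncard_insert_le _ _).trans hu)
  by_cases hvs : v = s
  · exact hinsert v t (hvs ▸ hs) fun w hw => by
      rw [SimpleGraph.sup_adj, SimpleGraph.edge_adj] at hw; grind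
  by_cases hvt : v = t
  · exact hinsert v s (hvt ▸ ht) fun w hw => by
      rw [SimpleGraph.sup_adj, SimpleGraph.edge_adj] at hw; grind
  exact (deg_le_ncard fun w hw => adj_of_sup_edge_of_ne hw (by tauto) (by tauto)).trans (hd v)

lemma colorable_of_isolate_singleton {n : ℕ} {x : V} (hd : deg G x < n)
    (h : (isolate G {x}).Colorable n) : G.Colorable n := by
  classical
  obtain ⟨c⟩ := h
  obtain ⟨a, ha⟩ : ∃ a, a ∉ c '' G.neighborSet x := by
    by_contra! hall
    have := Set.ncard_image_le (f := c) (Set.toFinite (G.neighborSet x))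
    rw [Set.eq_univ_of_forall hall, Set.ncard_univ, Nat.card_fin, ← deg] at this
    omega
  refine colorable_of_coloring_isolate c (Function.update c x a)
    (fun v hv => Function.update_of_ne hv _ _) ?_
  rintro v rfl w hw h
  rw [Function.update_self, Function.update_of_ne hw.ne.symm] at h
  exact ha ⟨w, hw, h.symm⟩

lemma exists_forall_nbr_of_deg_le_three {v a b : V} (hd : deg G v ≤ 3) (ha : G.Adj v a)
    (hb : G.Adj v b) (hab : a ≠ b) : ∃ c, ∀ w, G.Adj v w → w = a ∨ w = b ∨ w = c := by
  by_cases h : ∃ c, G.Adj v c ∧ a ≠ c ∧ b ≠ c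
  · obtain ⟨c, hc, hac, hbc⟩ := h
    exact ⟨c, fun w => eq_of_deg_le_three hd ha hb hc hab hac hbc⟩
  · exact ⟨a, fun w hw => by grind⟩

lemma colorable_three_of_isolate_diamond (hmax : ∀ v, deg G v ≤ 3) {a b u v : V}
    (hab : G.Adj a b) (hau : G.Adj a u) (hav : G.Adj a v) (hbu : G.Adj b u) (hbv : G.Adj b v)
    (huv : u ≠ v) (hnuv : ¬ G.Adj u v) (h : (isolate G {a, b, u, v}).Colorable 3) :
    G.Colorable 3 := by
  classical
  obtain ⟨c⟩ := h
  have hNa : ∀ w, G.Adj a w → w = b ∨ w = u ∨ w = v := fun w =>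
    eq_of_deg_le_three (hmax a) hab hau hav hbu.ne hbv.ne huv
  have hNb : ∀ w, G.Adj b w → w = a ∨ w = u ∨ w = v := fun w =>
    eq_of_deg_le_three (hmax b) hab.symm hbu hbv hau.ne hav.ne huv
  obtain ⟨u', hNu⟩ := exists_forall_nbr_of_deg_le_three (hmax u) hau.symm hbu.symm hab.ne
  obtain ⟨v', hNv⟩ := exists_forall_nbr_of_deg_le_three (hmax v) hav.symm hbv.symm hab.ne
  obtain ⟨p, q, r, hpq, hpr, hqr, hpu, hpv⟩ := exists_diamond_colors (c u') (c v')
  refine colorable_of_coloring_isolate c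
    (fun w => if w = u ∨ w = v then p else if w = a then q else if w = b then r else c w) ?_ ?_
  · grind
  · have hnvu : ¬ G.Adj v u := fun h => hnuv h.symm
    have hne := And.intro hab.ne (And.intro hau.ne (And.intro hav.ne (And.intro hbu.ne hbv.ne)))
    rintro x (rfl | rfl | rfl | rfl) w hw
    · have := hNa w hw; grind
    · have := hNb w hw; grind
    · have := hNu w hw; have := hw.ne; grind
    · have := hNv w hw; have := hw.ne; grind

lemma exists_reduction_of_diamondFree (hreg : ∀ v, deg G v = 0 ∨ deg G v = 3)
    (hcf : ClawFree G) (hdf : DiamondFree G) {x : V} (hx : x ∈ G.support) :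
    ∃ H : SimpleGraph V, H.support ⊂ G.support ∧ (∀ v, deg H v ≤ 3) ∧ ClawFree H ∧
      H.CliqueFree 4 ∧ (H.Colorable 3 → G.Colorable 3) := by
  have hdeg : ∀ {v w}, G.Adj v w → deg G v = 3 := fun {v w} h =>
    (hreg v).resolve_left (deg_pos_iff.2 ⟨w, h⟩).ne'
  obtain ⟨w₀, hw₀⟩ := hx
  -- The triangle `x y z` is removed; the new edge `x' y'` keeps the colors that `x` and `y` have to
  -- avoid distinct.
  obtain ⟨y, z, x', hx'y, hx'z, hxy, hxz, hyz, hxx', hNx⟩ := hcf.exists_triangle (hdeg hw₀)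
  obtain ⟨y', hy'x, hy'z, hyy', hNy⟩ :=
    exists_third_of_deg_three (hdeg hyz) hxy.symm hyz hxz.ne
  obtain ⟨z', hz'x, hz'y, hzz', hNz⟩ :=
    exists_third_of_deg_three (hdeg hyz.symm) hxz.symm hyz.symm hxy.ne
  have hne : x' ≠ y' := by
    rintro rfl
    exact hx'z (hdf x y x' z hxy hxx' hxz hyy' hyz)
  set D : Set V := {x, y, z} with hD
  have hx'D : x' ∉ D := by simp [hD, hx'y, hx'z, hxx'.ne.symm]
  have hy'D : y' ∉ D := by simp [hD, hy'x, hy'z, hyy'.ne.symm]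
  have hz'D : z' ∉ D := by simp [hD, hz'x, hz'y, hzz'.ne.symm]
  refine ⟨isolate G D ⊔ SimpleGraph.edge x' y', support_isolate_sup_edge_ssubset (x := x) (y := y)
    (by simp [hD]) hx'D hy'D hxx' hyy', ?_, ?_, ?_, ?_⟩
  · exact deg_sup_edge_le
      (fun v => (deg_mono isolate_le v).trans (by rcases hreg v with h | h <;> omega))
      ((deg_isolate_lt hxx'.symm (by simp [hD])).trans_eq (hdeg hxx'.symm))
      ((deg_isolate_lt hyy'.symm (by simp [hD])).trans_eq (hdeg hyy'.symm))
  · exact (clawFree_isolate hcf).sup_edge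
      (hcf.isClique_neighborSet_isolate hxx' (by simp [hD])
        fun w hw => by have := hNx w hw; simp only [hD, Set.mem_insert_iff]; tauto)
      (hcf.isClique_neighborSet_isolate hyy' (by simp [hD])
        fun w hw => by have := hNy w hw; simp only [hD, Set.mem_insert_iff]; tauto)
  · exact (hdf.mono isolate_le).cliqueFree_sup_edge x' y'
  · rintro ⟨c⟩
    exact colorable_three_of_coloring_isolate_triangle (by grind) (by grind [G.adj_comm])
      (by grind [G.adj_comm]) hx'D hy'D hz'D (c.comp (.ofLE le_sup_left))
      (c.valid (.inr ((SimpleGraph.edge_adj ..).2 ⟨.inl ⟨rfl, rfl⟩, hne⟩)))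

theorem ClawFree.colorable_three (hcf : ClawFree G) (hmax : ∀ v, deg G v ≤ 3)
    (hK4 : G.CliqueFree 4) : G.Colorable 3 := by
  induction hm : G.support.ncard using Nat.strong_induction_on generalizing G with
  | _ m ih =>
  subst hm
  have hsmaller : ∀ H : SimpleGraph V, H.support ⊂ G.support → (∀ v, deg H v ≤ 3) → ClawFree H →
      H.CliqueFree 4 → H.Colorable 3 := fun H hlt hmax hcf hK4 =>
    ih _ (Set.ncard_lt_ncard hlt (Set.toFinite _)) hcf hmax hK4 rfl
  have hisolate : ∀ (D : Set V) (x y : V), x ∈ D → G.Adj x y → (isolate G D).Colorable 3 :=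
    fun D x y hxD hxy => hsmaller _
      ⟨support_isolate_subset.trans Set.sdiff_subset,
        fun h => (support_isolate_subset (h ⟨y, hxy⟩)).2 hxD⟩
      (fun v => (deg_mono isolate_le v).trans (hmax v)) (clawFree_isolate hcf)
      (hK4.anti isolate_le)
  by_cases hreg : ∀ v, deg G v = 0 ∨ deg G v = 3
  swap
  · push Not at hreg
    obtain ⟨x, hx0, hx3⟩ := hreg
    obtain ⟨y, hxy⟩ := deg_pos_iff.1 (Nat.pos_of_ne_zero hx0)
    exact colorable_of_isolate_singleton ((hmax x).lt_of_ne hx3) (hisolate _ x y rfl hxy)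
  by_cases hdf : DiamondFree G
  swap
  · simp only [DiamondFree, not_forall] at hdf
    obtain ⟨a, b, u, v, hab, hau, hav, hbu, hbv, huv⟩ := hdf
    have hnuv : ¬ G.Adj u v := cliqueFree_four_iff.1 hK4 a b u v hab hau hav hbu hbv
    exact colorable_three_of_isolate_diamond hmax hab hau hav hbu hbv huv hnuv
      (hisolate _ a b (by simp) hab)
  rcases G.support.eq_empty_or_nonempty with hempty | ⟨x, hx⟩
  · exact ⟨SimpleGraph.Coloring.mk (fun _ => 0) fun {u v} h =>
      absurd (hempty ▸ (⟨v, h⟩ : u ∈ G.support)) (Set.notMem_empty u)⟩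
  · obtain ⟨H, hlt, hHmax, hHcf, hHK4, hcol⟩ := exists_reduction_of_diamondFree hreg hcf hdf hx
    exact hcol (hsmaller H hlt hHmax hHcf hHK4)

end Coloring

/-! ### Threads -/

section Threads

variable {V : Type*} {G : SimpleGraph V}

lemma forall_of_connected (hconn : G.Connected) {p : V → Prop}
    (hp : ∀ v w, p v → G.Adj v w → p w) {v : V} (hv : p v) (w : V) : p w := by
  have hvw := hconn.preconnected v w
  rw [SimpleGraph.reachable_iff_reflTransGen] at hvw
  induction hvw with
  | refl => exact hv
  | tail _ hadj ih => exact hp _ _ ih hadj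

/-- `x 0, …, x k` is a thread: a walk that does not turn back and whose internal vertices have
degree 2. The ends may coincide, and the terms of `x` beyond `x k` are irrelevant. -/
def IsThread (G : SimpleGraph V) (x : ℕ → V) (k : ℕ) : Prop :=
  (∀ m < k, G.Adj (x m) (x (m + 1))) ∧
  ∀ m, m + 1 < k → deg G (x (m + 1)) = 2 ∧ x m ≠ x (m + 2)

lemma IsThread.reverse {x : ℕ → V} {k : ℕ} (hx : IsThread G x k) :
    IsThread G (fun m => x (k - m)) k := by
  refine ⟨fun m hm => ?_, fun m hm => ?_⟩
  · have := hx.1 (k - (m + 1)) (by omega)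
    rw [show k - (m + 1) + 1 = k - m by omega] at this
    exact this.symm
  · have := hx.2 (k - (m + 2)) (by omega)
    rw [show k - (m + 2) + 1 = k - (m + 1) by omega,
      show k - (m + 2) + 2 = k - m by omega] at this
    exact ⟨this.1, this.2.symm⟩

lemma IsThread.adj_last {x : ℕ → V} {k : ℕ} (hx : IsThread G x k) (hk : 0 < k) :
    G.Adj (x k) (x (k - 1)) := by
  simpa [Nat.sub_add_cancel hk] using (hx.1 (k - 1) (by omega)).symm

/-- One step along a thread: a pair `(a, b)` of consecutive vertices is replaced by `(b, c)`,
where `c ≠ a` is a neighbor of `b`. At a dead end, that is, if there is no such `c`, the step turns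
back. -/
noncomputable def advance (G : SimpleGraph V) (d : V × V) : V × V :=
  open Classical in
  (d.2, if h : ∃ w, w ≠ d.1 ∧ G.Adj d.2 w then h.choose else d.1)

/-- The sequence that starts with `u`, `w` and then moves on by `advance`. It is a thread up to its
first later vertex of degree other than 2, and arbitrary after it. -/
noncomputable def track (G : SimpleGraph V) (u w : V) (m : ℕ) : V := ((advance G)^[m] (u, w)).1

lemma track_zero (u w : V) : track G u w 0 = u := rfl

lemma track_succ (u w : V) (m : ℕ) : track G u w (m + 1) = ((advance G)^[m] (u, w)).2 := by
  rw [track, Function.iterate_succ_apply']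
  rfl

lemma track_one (u w : V) : track G u w 1 = w := track_succ u w 0

lemma iterate_advance (u w : V) (m : ℕ) :
    (advance G)^[m] (u, w) = (track G u w m, track G u w (m + 1)) := by
  rw [track_succ, track]

lemma track_add_two (u w : V) (m : ℕ) (h : deg G (track G u w (m + 1)) = 2) :
    track G u w (m + 2) ≠ track G u w m ∧
      G.Adj (track G u w (m + 1)) (track G u w (m + 2)) := by
  have hex := exists_ne_of_deg_two h (track G u w m)
  have hstep : track G u w (m + 2) = hex.choose := by
    rw [track_succ, Function.iterate_succ_apply', iterate_advance, advance, dif_pos hex]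
  rw [hstep]
  exact hex.choose_spec

lemma isThread_track {u w : V} (huw : G.Adj u w) {k : ℕ}
    (h : ∀ m, m + 1 < k → deg G (track G u w (m + 1)) = 2) : IsThread G (track G u w) k := by
  refine ⟨fun m hm => ?_, fun m hm => ⟨h m hm, (track_add_two u w m (h m hm)).1.symm⟩⟩
  rcases m with _ | m
  · rw [track_one, track_zero]; exact huw
  · exact (track_add_two u w m (h m (by omega))).2

variable [Finite V]

lemma IsThread.eq_or_eq {x : ℕ → V} {k m : ℕ} (hx : IsThread G x k) (hm : m + 1 < k) {w : V}
    (hw : G.Adj (x (m + 1)) w) : w = x m ∨ w = x (m + 2) :=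
  eq_or_eq_of_deg_le_two (hx.2 m hm).1.le (hx.1 m (by omega)).symm (hx.1 (m + 1) hm)
    (hx.2 m hm).2 hw

lemma IsThread.exists_eq_start {x : ℕ → V} {k : ℕ} (hx : IsThread G x k) :
    ∀ i j, i < j → i + j ≤ k → x i = x j → ∃ l, 0 < l ∧ l ≤ i + j ∧ x 0 = x l := by
  intro i
  induction i with
  | zero => exact fun j hj _ h => ⟨j, hj, by omega, h⟩
  | succ i ih =>
    intro j hj hk h
    obtain ⟨j, rfl⟩ := Nat.exists_eq_add_one_of_ne_zero (n := j) (by omega)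
    rcases hx.eq_or_eq (m := j) (by omega) (h ▸ (hx.1 i (by omega)).symm) with h' | h'
    · obtain ⟨l, h1, h2, h3⟩ := ih j (by omega) (by omega) h'
      exact ⟨l, h1, by omega, h3⟩
    · obtain ⟨l, h1, h2, h3⟩ := ih (j + 2) (by omega) (by omega) h'
      exact ⟨l, h1, by omega, h3⟩

lemma IsThread.ne_of_lt {x : ℕ → V} {k : ℕ} (hx : IsThread G x k) (h0 : deg G (x 0) ≠ 2)
    (hk : deg G (x k) ≠ 2) (hne : x 0 ≠ x k) : ∀ i j, i < j → j ≤ k → x i ≠ x j := by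
  intro i
  induction i with
  | zero =>
    intro j hj hjk h
    rcases hjk.lt_or_eq with h' | rfl
    · obtain ⟨j, rfl⟩ := Nat.exists_eq_add_one_of_ne_zero (n := j) (by omega)
      exact h0 (h ▸ (hx.2 j h').1)
    · exact hne h
  | succ i ih =>
    intro j hj hjk h
    rcases hjk.lt_or_eq with h' | rfl
    · obtain ⟨j, rfl⟩ := Nat.exists_eq_add_one_of_ne_zero (n := j) (by omega)
      rcases hx.eq_or_eq h' (h ▸ (hx.1 i (by omega)).symm) with h'' | h''
      · exact ih j (by omega) (by omega) h''
      · exact ih (j + 2) (by omega) (by omega) h''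
    · exact hk (h ▸ (hx.2 i hj).1)

lemma IsThread.injOn {x : ℕ → V} {k : ℕ} (hx : IsThread G x k) (h0 : deg G (x 0) ≠ 2)
    (hk : deg G (x k) ≠ 2) (hne : x 0 ≠ x k) : Set.InjOn x {i | i ≤ k} := by
  intro i hi j hj h
  rcases lt_trichotomy i j with h' | h' | h'
  · exact absurd h (hx.ne_of_lt h0 hk hne i j h' hj)
  · exact h'
  · exact absurd h.symm (hx.ne_of_lt h0 hk hne j i h' hi)

lemma exists_track_end {u w : V} (huw : G.Adj u w) (hu : deg G u ≠ 2) :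
    ∃ k, 0 < k ∧ IsThread G (track G u w) k ∧ deg G (track G u w k) ≠ 2 := by
  classical
  have hex : ∃ k, deg G (track G u w (k + 1)) ≠ 2 := by
    by_contra! h
    have ht : ∀ k, IsThread G (track G u w) k := fun k => isThread_track huw fun m _ => h m
    obtain ⟨i, j, hij, he⟩ := Finite.exists_ne_map_eq_of_infinite (track G u w)
    wlog hlt : i < j generalizing i j
    · exact this j i hij.symm he.symm (by omega)
    obtain ⟨l, hl, -, hl'⟩ := (ht (i + j)).exists_eq_start i j hlt le_rfl he
    obtain ⟨l, rfl⟩ := Nat.exists_eq_add_one_of_ne_zero (n := l) (by omega)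
    exact hu (by rw [← track_zero (G := G) u w, hl']; exact h l)
  refine ⟨Nat.find hex + 1, by omega, isThread_track huw fun m hm => ?_, Nat.find_spec hex⟩
  exact not_not.1 (Nat.find_min hex (by omega))

lemma IsThread.eq_of_start_eq {x y : ℕ → V} {k l : ℕ} (hx : IsThread G x k) (hy : IsThread G y l)
    (h0 : x 0 = y 0) (h1 : x 1 = y 1) : ∀ m, m ≤ k → m ≤ l → x m = y m := by
  intro m
  induction m using Nat.strong_induction_on with
  | _ m ih =>
    intro hk hl
    match m with
    | 0 => exact h0
    | 1 => exact h1
    | m + 2 =>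
      have e0 := ih m (by omega) (by omega) (by omega)
      have e1 := ih (m + 1) (by omega) (by omega) (by omega)
      have := hy.1 (m + 1) (by omega)
      rw [← e1] at this
      rcases hx.eq_or_eq (by omega) this with h | h
      · exact absurd (e0.symm.trans h.symm) (hy.2 m (by omega)).2
      · exact h.symm

lemma IsThread.length_eq {x y : ℕ → V} {k l : ℕ} (hx : IsThread G x k) (hy : IsThread G y l)
    (hxk : deg G (x k) ≠ 2) (hyl : deg G (y l) ≠ 2) (hk : 0 < k) (hl : 0 < l)
    (h0 : x 0 = y 0) (h1 : x 1 = y 1) : k = l := by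
  have := hx.eq_of_start_eq hy h0 h1
  obtain ⟨k, rfl⟩ := Nat.exists_eq_add_one_of_ne_zero (n := k) (by omega)
  obtain ⟨l, rfl⟩ := Nat.exists_eq_add_one_of_ne_zero (n := l) (by omega)
  rcases lt_trichotomy k l with h | h | h
  · exact absurd (hy.2 k (by omega)).1 (by rwa [← this (k + 1) le_rfl (by omega)])
  · rw [h]
  · exact absurd (hx.2 l (by omega)).1 (by rwa [this (l + 1) (by omega) le_rfl])

lemma IsThread.second_ne_penultimate {x : ℕ → V} {k : ℕ} (hx : IsThread G x k) (hk : 0 < k)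
    (h0 : x 0 = x k) : x 1 ≠ x (k - 1) := by
  intro h1
  -- Otherwise the thread is a palindrome, and it turns back or stands still in its middle.
  have hpal := hx.eq_of_start_eq hx.reverse (by simpa using h0) h1
  obtain ⟨m, rfl | rfl⟩ := Nat.even_or_odd' k
  · obtain ⟨m, rfl⟩ := Nat.exists_eq_add_one_of_ne_zero (n := m) (by omega)
    have := hpal m (by omega) (by omega)
    rw [show 2 * (m + 1) - m = m + 2 by omega] at this
    exact (hx.2 m (by omega)).2 this
  · have := hpal m (by omega) (by omega)
    rw [show 2 * m + 1 - m = m + 1 by omega] at this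
    exact (hx.1 m (by omega)).ne this

lemma IsThread.length_eq_three_of_triangle {x : ℕ → V} {k : ℕ} (hx : IsThread G x k)
    (hk : 0 < k) (h0 : x 0 = x k) (hd : deg G (x 0) ≠ 2)
    (htri : ∃ q, G.Adj (x 1) q ∧ G.Adj (x 0) q) : k = 3 := by
  obtain ⟨q, hq1, hq0⟩ := htri
  have h1 : k ≠ 1 := by
    rintro rfl
    exact (hx.1 0 hk).ne h0
  have h2 : k ≠ 2 := by
    rintro rfl
    exact (hx.2 0 (by omega)).2 h0
  have hq : q = x 2 := (hx.eq_or_eq (m := 0) (by omega) hq1).resolve_left hq0.ne.symm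
  subst hq
  have h3 : x 0 = x 3 :=
    (hx.eq_or_eq (m := 1) (by omega) hq0.symm).resolve_left (hx.1 0 (by omega)).ne
  by_contra hk3
  exact hd (h3 ▸ (hx.2 2 (by omega)).1)

lemma IsThread.length_eq_three {x : ℕ → V} {k : ℕ} (hcf : ClawFree G) (hx : IsThread G x k)
    (hk : 0 < k) (h0 : x 0 = x k) (hd : deg G (x 0) = 3) : k = 3 := by
  obtain ⟨p, q, r, -, -, hp, hq, hpq, -, hall⟩ := hcf.exists_triangle hd
  have htri : ∀ w, w = p ∨ w = q → ∃ z, G.Adj w z ∧ G.Adj (x 0) z := by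
    rintro w (rfl | rfl)
    exacts [⟨q, hpq, hq⟩, ⟨p, hpq.symm, hp⟩]
  by_cases h1 : x 1 = r
  · have hpen : x (k - 1) = p ∨ x (k - 1) = q := by
      have := hall _ (h0 ▸ hx.adj_last hk)
      have := hx.second_ne_penultimate hk h0
      grind
    have hend : x (k - 0) = x 0 := h0.symm
    exact hx.reverse.length_eq_three_of_triangle hk (by simpa using h0.symm)
      (by simp only [hend, hd]; norm_num) (by simpa only [hend] using htri _ hpen)
  · have := hall _ (hx.1 0 hk)
    exact hx.length_eq_three_of_triangle hk h0 (by omega) (htri _ (by tauto))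

lemma IsThread.mod_three_eq {x : ℕ → V} {k : ℕ} (hmax : ∀ v, deg G v ≤ 3) (hcf : ClawFree G)
    (hx : IsThread G x k) (h0 : deg G (x 0) ≠ 2) (hk : deg G (x k) ≠ 2) {i j : ℕ} (hi : i ≤ k)
    (hj : j ≤ k) (h : x i = x j) : i % 3 = j % 3 := by
  by_cases hne : x 0 = x k
  swap
  · rw [hx.injOn h0 hk hne hi hj h]
  rcases Nat.eq_zero_or_pos k with rfl | hpos
  · rw [show i = j by omega]
  have a1 := hx.1 0 hpos
  have a2 := hne ▸ hx.adj_last hpos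
  have hd : deg G (x 0) = 3 := by
    have h3 := hmax (x 0)
    by_contra h'
    exact hx.second_ne_penultimate hpos hne (eq_of_deg_le_one (by omega) a2 a1)
  obtain rfl := hx.length_eq_three hcf hpos hne hd
  have b1 := (hx.1 0 (by omega)).ne
  have b2 := (hx.1 1 (by omega)).ne
  have b3 := (hx.1 2 (by omega)).ne
  simp only [Nat.reduceAdd, zero_add] at b1 b2 b3
  interval_cases i <;> interval_cases j <;> grind

lemma exists_thread_through [Nontrivial V] (hconn : G.Connected) {v₀ : V} (h₀ : deg G v₀ ≠ 2)
    (y : V) : ∃ x k m, IsThread G x k ∧ deg G (x 0) ≠ 2 ∧ deg G (x k) ≠ 2 ∧ 0 < k ∧ m ≤ k ∧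
      x m = y := by
  obtain ⟨w₀, hw₀⟩ := hconn.preconnected.exists_adj_of_nontrivial v₀
  obtain ⟨k₀, hk₀, ht₀, he₀⟩ := exists_track_end hw₀ h₀
  refine forall_of_connected hconn (p := fun y => ∃ x k m, IsThread G x k ∧ deg G (x 0) ≠ 2 ∧
    deg G (x k) ≠ 2 ∧ 0 < k ∧ m ≤ k ∧ x m = y) ?_
    ⟨_, k₀, 0, ht₀, h₀, he₀, hk₀, Nat.zero_le _, track_zero v₀ w₀⟩ y
  rintro _ w ⟨x, k, m, hx, h0, hk, hkpos, hm, rfl⟩ hadj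
  by_cases hd : deg G (x m) = 2
  · have hm0 : m ≠ 0 := by rintro rfl; exact h0 hd
    have hmk : m ≠ k := by rintro rfl; exact hk hd
    obtain ⟨m, rfl⟩ := Nat.exists_eq_add_one_of_ne_zero hm0
    rcases hx.eq_or_eq (by omega) hadj with rfl | rfl
    · exact ⟨x, k, m, hx, h0, hk, hkpos, by omega, rfl⟩
    · exact ⟨x, k, m + 2, hx, h0, hk, hkpos, by omega, rfl⟩
  · obtain ⟨l, hl, ht, he⟩ := exists_track_end hadj hd
    exact ⟨_, l, 1, ht, hd, he, hl, hl, track_one _ _⟩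

end Threads

/-! ### Threads and the paths `A_i` -/

section Core

variable {V : Type*} {G : SimpleGraph V}

lemma exists_walk_of_adj {x : ℕ → V} {k : ℕ} (hx : ∀ m < k, G.Adj (x m) (x (m + 1))) :
    ∃ p : G.Walk (x 0) (x k), p.length = k ∧ p.support = (List.range (k + 1)).map x := by
  induction k with
  | zero => exact ⟨.nil, rfl, by simp⟩
  | succ k ih =>
    obtain ⟨p, hl, hs⟩ := ih fun m hm => hx m (by omega)
    refine ⟨p.concat (hx k (by omega)), by simp [hl], ?_⟩
    rw [SimpleGraph.Walk.support_concat, hs, List.range_succ (n := k + 1)]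
    simp

/-- The sequence `a, b, c, d, d, …`, which lists the vertices of a short thread. -/
def firstTerms (a b c d : V) : ℕ → V
  | 0 => a
  | 1 => b
  | 2 => c
  | _ => d

lemma isThread_one {u v : V} (h : G.Adj u v) : IsThread G (firstTerms u v v v) 1 :=
  ⟨fun m hm => (by omega : m = 0) ▸ h, fun _ hm => absurd hm (by omega)⟩

lemma isThread_two {u v w : V} (h : G.Adj u v) (h' : G.Adj v w) (hd : deg G v = 2) (hne : u ≠ w) :
    IsThread G (firstTerms u v w w) 2 := by
  refine ⟨fun m hm => ?_, fun m hm => ?_⟩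
  · interval_cases m
    exacts [h, h']
  · obtain rfl : m = 0 := by omega
    exact ⟨hd, hne⟩

lemma isThread_three {u v w : V} (h : G.Adj u v) (h' : G.Adj v w) (h'' : G.Adj w u)
    (hv : deg G v = 2) (hw : deg G w = 2) :
    IsThread G (firstTerms u v w u) 3 := by
  refine ⟨fun m hm => ?_, fun m hm => ?_⟩
  · interval_cases m
    exacts [h, h', h'']
  · have : m < 2 := by omega
    interval_cases m
    exacts [⟨hv, h''.ne.symm⟩, ⟨hw, h.ne.symm⟩]

lemma nonempty_iso_of_closed {W : Type*} {K : SimpleGraph W} [Nonempty W] (hconn : G.Connected)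
    (f : W → V) (hinj : Function.Injective f) (hadj : ∀ s t, K.Adj s t → G.Adj (f s) (f t))
    (hcl : ∀ s w, G.Adj (f s) w → ∃ t, K.Adj s t ∧ f t = w) : Nonempty (G ≃g K) := by
  have hsurj : Function.Surjective f :=
    forall_of_connected hconn (p := fun y => ∃ s, f s = y)
      (by rintro _ w ⟨s, rfl⟩ hw; exact (hcl s w hw).imp fun _ h => h.2)
      ⟨Classical.arbitrary W, rfl⟩
  refine ⟨SimpleGraph.Iso.symm ⟨Equiv.ofBijective f ⟨hinj, hsurj⟩, fun {s t} => ?_⟩⟩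
  refine ⟨fun h => ?_, hadj s t⟩
  obtain ⟨t', ht', he⟩ := hcl s _ h
  rwa [← hinj he]

/-- The graph of threads: vertices of degree 3 are adjacent in it if they are the ends of a thread.
The other vertices are kept as isolated vertices. -/
def core (G : SimpleGraph V) : SimpleGraph V where
  Adj u v := u ≠ v ∧ deg G u = 3 ∧ deg G v = 3 ∧ ∃ x k, IsThread G x k ∧ x 0 = u ∧ x k = v
  symm := ⟨fun _ _ h => by
    obtain ⟨h1, h2, h3, x, k, hx, h4, h5⟩ := h
    exact ⟨h1.symm, h3, h2, _, k, hx.reverse, by simpa using h5, by simpa using h4⟩⟩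
  loopless := ⟨fun _ h => h.1 rfl⟩

lemma core_adj_of_adj {u v : V} (h : G.Adj u v) (hu : deg G u = 3) (hv : deg G v = 3) :
    (core G).Adj u v := ⟨h.ne, hu, hv, _, 1, isThread_one h, rfl, rfl⟩

lemma HasA.exists_isThread {k : ℕ} (hk : 0 < k) (h : HasA G (k + 1)) :
    ∃ x, IsThread G x k ∧ deg G (x 0) = 3 ∧ deg G (x k) = 3 ∧ x 0 ≠ x k := by
  obtain ⟨u, v, p, hp, hl, hu, hv, hin⟩ := h
  obtain rfl : p.length = k := by omega
  have hinj : ∀ i j, i ≤ p.length → j ≤ p.length → i ≠ j → p.getVert i ≠ p.getVert j :=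
    fun i j hi hj => mt (hp.getVert_injOn hi hj)
  refine ⟨p.getVert, ⟨fun m hm => p.adj_getVert_succ hm, fun m hm => ⟨?_, ?_⟩⟩, by simpa,
    by simpa, ?_⟩
  · refine hin _ (p.getVert_mem_support _) ?_ ?_
    · simpa using hinj (m + 1) 0 (by omega) (by omega) (by omega)
    · simpa using hinj (m + 1) p.length (by omega) le_rfl (by omega)
  · exact hinj _ _ (by omega) (by omega) (by omega)
  · exact hinj 0 p.length (by omega) le_rfl hk.ne

variable [Finite V]

lemma IsThread.hasA {x : ℕ → V} {k : ℕ} (hx : IsThread G x k) (h0 : deg G (x 0) = 3)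
    (hk : deg G (x k) = 3) (hne : x 0 ≠ x k) : HasA G (k + 1) := by
  have hinj : Set.InjOn x {i | i ≤ k} := hx.injOn (by omega) (by omega) hne
  obtain ⟨p, hl, hs⟩ := exists_walk_of_adj hx.1
  refine ⟨x 0, x k, p, ?_, by omega, h0, hk, fun w hw hw0 hwk => ?_⟩
  · rw [SimpleGraph.Walk.isPath_def, hs]
    exact List.Nodup.map_on (fun i hi j hj => hinj (Nat.le_of_lt_succ (List.mem_range.1 hi))
      (Nat.le_of_lt_succ (List.mem_range.1 hj))) List.nodup_range
  · rw [hs, List.mem_map] at hw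
    obtain ⟨m, hm, rfl⟩ := hw
    rw [List.mem_range] at hm
    have hm0 : m ≠ 0 := by rintro rfl; exact hw0 rfl
    have hmk : m ≠ k := by rintro rfl; exact hwk rfl
    obtain ⟨m, rfl⟩ := Nat.exists_eq_add_one_of_ne_zero hm0
    exact (hx.2 m (by omega)).1

lemma IsThread.mod_three_ne_zero {x : ℕ → V} {k : ℕ}
    (hA : ∀ j : ℕ, 1 ≤ j → ¬ HasA G (3 * j + 1)) (hx : IsThread G x k) (h0 : deg G (x 0) = 3)
    (hk : deg G (x k) = 3) (hne : x 0 ≠ x k) : k % 3 ≠ 0 := by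
  intro h
  have : k ≠ 0 := by rintro rfl; exact hne rfl
  refine hA (k / 3) (by omega) ?_
  rw [show 3 * (k / 3) = k by omega]
  exact hx.hasA h0 hk hne

/-! ### The graph of threads between vertices of degree 3 -/

/-- The number of edges of the thread that starts with `u`, `w` and ends at the next vertex of
degree other than 2. It is 0, a junk value, if there is no such thread. -/
noncomputable def threadLength (G : SimpleGraph V) (u w : V) : ℕ :=
  open Classical in
  if h : ∃ k, 0 < k ∧ IsThread G (track G u w) k ∧ deg G (track G u w k) ≠ 2 then h.choose else 0

/-- The last vertex of the thread of length `threadLength G u w` that starts with `u`, `w`. -/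
noncomputable def tip (G : SimpleGraph V) (u w : V) : V := track G u w (threadLength G u w)

lemma threadLength_spec {u w : V} (huw : G.Adj u w) (hu : deg G u ≠ 2) :
    0 < threadLength G u w ∧ IsThread G (track G u w) (threadLength G u w) ∧
      deg G (tip G u w) ≠ 2 := by
  have h := exists_track_end huw hu
  rw [tip, threadLength, dif_pos h]
  exact h.choose_spec

lemma threadLength_eq {u w : V} {x : ℕ → V} {k : ℕ} (hu : deg G u ≠ 2) (hx : IsThread G x k)
    (hk : 0 < k) (hd : deg G (x k) ≠ 2) (h0 : x 0 = u) (h1 : x 1 = w) :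
    threadLength G u w = k ∧ tip G u w = x k := by
  have huw : G.Adj u w := by
    have := hx.1 0 hk
    rwa [h0, h1] at this
  obtain ⟨a, b, c⟩ := threadLength_spec huw hu
  have e := b.length_eq hx c hd a hk (by rw [h0, track_zero]) (by rw [h1, track_one])
  refine ⟨e, ?_⟩
  rw [tip, ← b.eq_of_start_eq hx (by rw [h0, track_zero]) (by rw [h1, track_one]) k e.ge le_rfl, e]

lemma core_neighborSet_subset (u : V) :
    (core G).neighborSet u ⊆ tip G u '' G.neighborSet u := by
  rintro _ ⟨hne, hu, hv, x, k, hx, rfl, rfl⟩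
  have hk : 0 < k := Nat.pos_of_ne_zero (by rintro rfl; exact hne rfl)
  exact ⟨x 1, hx.1 0 hk, (threadLength_eq (by omega) hx hk (by omega) rfl rfl).2⟩

lemma deg_core_le (hmax : ∀ v, deg G v ≤ 3) (u : V) : deg (core G) u ≤ 3 :=
  ((Set.ncard_le_ncard (core_neighborSet_subset u) (Set.toFinite _)).trans
    (Set.ncard_image_le (Set.toFinite _))).trans (hmax u)

lemma tip_of_deg_core_eq_three (hmax : ∀ v, deg G v ≤ 3) {u : V} (h : deg (core G) u = 3) :
    Set.InjOn (tip G u) (G.neighborSet u) ∧ ∀ w, G.Adj u w → (core G).Adj u (tip G u w) := by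
  have hsub := core_neighborSet_subset (G := G) u
  have h1 : (tip G u '' G.neighborSet u).ncard ≤ (G.neighborSet u).ncard :=
    Set.ncard_image_le (Set.toFinite _)
  have h2 : (G.neighborSet u).ncard ≤ 3 := hmax u
  have h3 : ((core G).neighborSet u).ncard = 3 := h
  have heq := Set.eq_of_subset_of_ncard_le hsub (by omega)
  refine ⟨Set.injOn_of_ncard_image_eq ?_ (Set.toFinite _), fun w hw => ?_⟩
  · rw [← heq] at h1 ⊢
    omega
  · have : tip G u w ∈ (core G).neighborSet u := by rw [heq]; exact ⟨w, hw, rfl⟩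
    exact this

lemma deg_eq_three_of_triangle (hmax : ∀ v, deg G v ≤ 3) {u a b : V} (h : deg (core G) u = 3)
    (ha : G.Adj u a) (hb : G.Adj u b) (hab : G.Adj a b) : deg G a = 3 := by
  obtain ⟨hinj, htip⟩ := tip_of_deg_core_eq_three hmax h
  have hu : deg G u ≠ 2 := by rw [(htip a ha).2.1]; norm_num
  by_contra hne
  have ha1 : ¬ deg G a ≤ 1 := fun hlt => hb.ne (eq_of_deg_le_one hlt hab ha.symm)
  have ha3 := hmax a
  have ha2 : deg G a = 2 := by omega
  by_cases hb2 : deg G b = 2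
  · have htip_self : tip G u a = u :=
      (threadLength_eq hu (isThread_three ha hab hb.symm ha2 hb2) (by omega) hu rfl rfl).2
    exact (htip a ha).ne htip_self.symm
  · have htip_b : tip G u b = b :=
      (threadLength_eq hu (isThread_one hb) (by omega) hb2 rfl rfl).2
    have htip_a : tip G u a = b :=
      (threadLength_eq hu (isThread_two ha hab ha2 hb.ne) (by omega) hb2 rfl rfl).2
    exact hab.ne (hinj ha hb (htip_a.trans htip_b.symm))

lemma exists_triangle_of_core_adj (hmax : ∀ v, deg G v ≤ 3) (hcf : ClawFree G) {s p q r : V}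
    (hp : (core G).Adj s p) (hq : (core G).Adj s q) (hr : (core G).Adj s r) (hpq : p ≠ q)
    (hpr : p ≠ r) (hqr : q ≠ r) :
    (G.Adj s p ∧ G.Adj s q ∧ G.Adj p q) ∨ (G.Adj s p ∧ G.Adj s r ∧ G.Adj p r) ∨
      (G.Adj s q ∧ G.Adj s r ∧ G.Adj q r) := by
  have hnbr : ∀ w, (core G).Adj s w → w = p ∨ w = q ∨ w = r := fun w =>
    eq_of_deg_le_three (deg_core_le hmax s) hp hq hr hpq hpr hqr
  have hd : deg (core G) s = 3 :=
    deg_eq_three_of_nbrs hpq hpr hqr fun w => ⟨hnbr w, by rintro (rfl | rfl | rfl) <;> assumption⟩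
  obtain ⟨y, z, -, -, -, hy, hz, hyz, -⟩ := hcf.exists_triangle hp.2.1
  have hy3 := deg_eq_three_of_triangle hmax hd hy hz hyz
  have hz3 := deg_eq_three_of_triangle hmax hd hz hy hyz.symm
  have hy' := hnbr y (core_adj_of_adj hy hp.2.1 hy3)
  have hz' := hnbr z (core_adj_of_adj hz hp.2.1 hz3)
  have hne := hyz.ne
  have hzy := hyz.symm
  grind

lemma clawFree_core (hmax : ∀ v, deg G v ≤ 3) (hcf : ClawFree G) : ClawFree (core G) := by
  intro v x y z hx hy hz hxy hyz hxz
  rcases exists_triangle_of_core_adj hmax hcf hx hy hz hxy hxz hyz with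
    ⟨-, -, h⟩ | ⟨-, -, h⟩ | ⟨-, -, h⟩
  exacts [.inl (core_adj_of_adj h hx.2.2.1 hy.2.2.1),
    .inr (.inr (core_adj_of_adj h hx.2.2.1 hz.2.2.1)),
    .inr (.inl (core_adj_of_adj h hy.2.2.1 hz.2.2.1))]

end Core

/-! ### `K₄` with a subdivided edge -/

section SubdividedK4

variable {V : Type*} {G : SimpleGraph V}

lemma k4Path_adj_inl {i : ℕ} {a b : Fin i} :
    (k4Path i).Adj (.inl a) (.inl b) ↔ a.val + 1 = b.val ∨ b.val + 1 = a.val := by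
  simp only [k4Path, SimpleGraph.fromRel_adj, ne_eq, Sum.inl.injEq, Fin.ext_iff]
  omega

lemma k4Path_adj_inl_inr {i : ℕ} {a : Fin i} {b : Fin 2} :
    (k4Path i).Adj (.inl a) (.inr b) ↔ a.val = 0 ∨ a.val + 1 = i := by
  simp [k4Path, SimpleGraph.fromRel_adj]

lemma k4Path_adj_inr_inl {i : ℕ} {a : Fin i} {b : Fin 2} :
    (k4Path i).Adj (.inr b) (.inl a) ↔ a.val = 0 ∨ a.val + 1 = i := by
  rw [SimpleGraph.adj_comm, k4Path_adj_inl_inr]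

lemma k4Path_adj_inr {i : ℕ} {a b : Fin 2} :
    (k4Path i).Adj (.inr a) (.inr b) ↔ a ≠ b := by
  simp [k4Path, SimpleGraph.fromRel_adj]

/-- A copy in `G` of `K₄` with an edge replaced by a path: the thread `x 0, …, x k` is the path, and
the ends of the thread and `y 0`, `y 1` form a `K₄` minus an edge. The degrees ensure that the copy
is a component of `G`. -/
structure IsSubdividedK4 (G : SimpleGraph V) (x : ℕ → V) (k : ℕ) (y : Fin 2 → V) : Prop where
  isThread : IsThread G x k
  start_ne_end : x 0 ≠ x k
  adj : ∀ s t, s ≠ t → G.Adj (y s) (y t)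
  adj_start : ∀ s, G.Adj (y s) (x 0)
  adj_end : ∀ s, G.Adj (y s) (x k)
  deg_start : deg G (x 0) = 3
  deg_end : deg G (x k) = 3
  deg_apex : ∀ s, deg G (y s) = 3

namespace IsSubdividedK4

variable {x : ℕ → V} {k : ℕ} {y : Fin 2 → V} (h : IsSubdividedK4 G x k y)
include h

lemma pos : 0 < k := Nat.pos_of_ne_zero (by rintro rfl; exact h.start_ne_end rfl)

lemma ne {m : ℕ} (hm : m ≤ k) (s : Fin 2) : x m ≠ y s := by
  rcases Nat.eq_zero_or_pos m with rfl | hm0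
  · exact (h.adj_start s).ne.symm
  rcases hm.eq_or_lt with rfl | hmk
  · exact (h.adj_end s).ne.symm
  obtain ⟨m, rfl⟩ := Nat.exists_eq_add_one_of_ne_zero hm0.ne'
  intro he
  have hd := h.deg_apex s
  rw [← he, (h.isThread.2 m hmk).1] at hd
  omega

lemma reverse : IsSubdividedK4 G (fun m => x (k - m)) k y where
  isThread := h.isThread.reverse
  start_ne_end := by simpa using h.start_ne_end.symm
  adj := h.adj
  adj_start := by simpa using h.adj_end
  adj_end := by simpa using h.adj_start
  deg_start := by simpa using h.deg_end
  deg_end := by simpa using h.deg_start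
  deg_apex := h.deg_apex

lemma map_adj : ∀ v w, (k4Path (k + 1)).Adj v w →
    G.Adj (Sum.elim (fun m : Fin (k + 1) => x m) y v)
      (Sum.elim (fun m : Fin (k + 1) => x m) y w) := by
  have hmixed : ∀ (m : Fin (k + 1)) (s : Fin 2), (k4Path (k + 1)).Adj (.inl m) (.inr s) →
      G.Adj (x m) (y s) := by
    intro m s hms
    rcases k4Path_adj_inl_inr.1 hms with hm | hm
    · rw [hm]
      exact (h.adj_start s).symm
    · rw [show m.val = k by omega]
      exact (h.adj_end s).symm
  rintro (m | s) (m' | s') hvw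
  · rcases k4Path_adj_inl.1 hvw with hm | hm
    · simpa [← hm] using h.isThread.1 m (by omega)
    · simpa [← hm] using (h.isThread.1 m' (by omega)).symm
  · exact hmixed m s' hvw
  · exact (hmixed m' s hvw.symm).symm
  · exact h.adj s s' (k4Path_adj_inr.1 hvw)

variable [Finite V]

lemma eq_of_adj_start {w : V} (hw : G.Adj (x 0) w) : (∃ s, w = y s) ∨ w = x 1 := by
  rcases eq_of_deg_le_three h.deg_start.le (h.adj_start 0).symm (h.adj_start 1).symm
    (h.isThread.1 0 h.pos) (h.adj 0 1 (by decide)).ne (h.ne h.pos 0).symm (h.ne h.pos 1).symm hw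
    with hw | hw | hw
  exacts [.inl ⟨0, hw⟩, .inl ⟨1, hw⟩, .inr hw]

lemma eq_of_adj_end {w : V} (hw : G.Adj (x k) w) : (∃ s, w = y s) ∨ w = x (k - 1) :=
  h.reverse.eq_of_adj_start (by simpa using hw)

lemma eq_of_adj_apex {s : Fin 2} {w : V} (hw : G.Adj (y s) w) :
    w = y (s + 1) ∨ w = x 0 ∨ w = x k :=
  have hne : s ≠ s + 1 := by fin_cases s <;> decide
  eq_of_deg_le_three (h.deg_apex s).le (h.adj s (s + 1) hne) (h.adj_start s) (h.adj_end s)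
    (h.adj_start (s + 1)).ne (h.adj_end (s + 1)).ne h.start_ne_end hw

lemma injective : Function.Injective (Sum.elim (fun m : Fin (k + 1) => x m) y) := by
  refine Function.Injective.sumElim (fun m m' he => Fin.ext ?_) (fun s t he => ?_)
    fun m s => h.ne (by omega) s
  · exact h.isThread.injOn (by rw [h.deg_start]; norm_num) (by rw [h.deg_end]; norm_num)
      h.start_ne_end (Fin.is_le m) (Fin.is_le m') he
  · by_contra hst
    exact (h.adj s t hst).ne he

lemma exists_adj_of_adj_map : ∀ v w, G.Adj (Sum.elim (fun m : Fin (k + 1) => x m) y v) w →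
    ∃ v', (k4Path (k + 1)).Adj v v' ∧ Sum.elim (fun m : Fin (k + 1) => x m) y v' = w := by
  have hk := h.pos
  rintro (⟨m, hm⟩ | s) w hw
  · rw [Sum.elim_inl] at hw
    rcases Nat.eq_zero_or_pos m with rfl | hm0
    · rcases h.eq_of_adj_start hw with ⟨s, rfl⟩ | rfl
      · exact ⟨.inr s, k4Path_adj_inl_inr.2 (.inl rfl), rfl⟩
      · exact ⟨.inl ⟨1, by omega⟩, k4Path_adj_inl.2 (.inl rfl), rfl⟩
    rcases (Nat.le_of_lt_succ hm).eq_or_lt with rfl | hmk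
    · rcases h.eq_of_adj_end hw with ⟨s, rfl⟩ | rfl
      · exact ⟨.inr s, k4Path_adj_inl_inr.2 (.inr rfl), rfl⟩
      · exact ⟨.inl ⟨m - 1, by omega⟩, k4Path_adj_inl.2 (.inr (by simp only; omega)), rfl⟩
    · obtain ⟨m, rfl⟩ := Nat.exists_eq_add_one_of_ne_zero hm0.ne'
      rcases h.isThread.eq_or_eq hmk hw with rfl | rfl
      · exact ⟨.inl ⟨m, by omega⟩, k4Path_adj_inl.2 (.inr rfl), rfl⟩
      · exact ⟨.inl ⟨m + 2, by omega⟩, k4Path_adj_inl.2 (.inl rfl), rfl⟩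
  · rcases h.eq_of_adj_apex hw with rfl | rfl | rfl
    · exact ⟨.inr (s + 1), k4Path_adj_inr.2 (by fin_cases s <;> decide), rfl⟩
    · exact ⟨.inl ⟨0, by omega⟩, k4Path_adj_inr_inl.2 (.inl rfl), rfl⟩
    · exact ⟨.inl ⟨k, by omega⟩, k4Path_adj_inr_inl.2 (.inr rfl), rfl⟩

lemma nonempty_iso (hconn : G.Connected) : Nonempty (G ≃g k4Path (k + 1)) :=
  nonempty_iso_of_closed hconn _ h.injective h.map_adj h.exists_adj_of_adj_map

end IsSubdividedK4

variable [Finite V]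

lemma inE_of_diamond (hconn : G.Connected) (hA : ∀ j : ℕ, 1 ≤ j → ¬ HasA G (3 * j + 1))
    {a b u v : V} (ha : deg G a = 3) (hb : deg G b = 3) (hab : G.Adj a b) (hau : G.Adj a u)
    (hav : G.Adj a v) (hbu : G.Adj b u) (hbv : G.Adj b v) (huv : (core G).Adj u v) : InE G := by
  obtain ⟨hne, hu, hv, x, k, hx, rfl, rfl⟩ := huv
  have hk3 := hx.mod_three_ne_zero hA hu hv hne
  have hK4 : IsSubdividedK4 G x k ![a, b] :=
    { isThread := hx
      start_ne_end := hne
      adj := by simp [Fin.forall_fin_two, hab, hab.symm]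
      adj_start := by simp [Fin.forall_fin_two, hau, hbu]
      adj_end := by simp [Fin.forall_fin_two, hav, hbv]
      deg_start := hu
      deg_end := hv
      deg_apex := by simp [Fin.forall_fin_two, ha, hb] }
  exact ⟨k + 1, (k + 2) / 3, by omega, by omega, hK4.nonempty_iso hconn⟩

lemma inE_of_core_clique (hconn : G.Connected) (hG : InC G) {s p q r : V}
    (hsp : (core G).Adj s p) (hsq : (core G).Adj s q) (hsr : (core G).Adj s r)
    (hpq : (core G).Adj p q) (hpr : (core G).Adj p r) (hqr : (core G).Adj q r)
    (h1 : G.Adj s p) (h2 : G.Adj s q) (h3 : G.Adj p q) : InE G := by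
  have hs := hsp.2.1
  have hp := hsp.2.2.1
  have hq := hsq.2.2.1
  rcases exists_triangle_of_core_adj hG.1 hG.2.1 hsr.symm hpr.symm hqr.symm hsp.ne hsq.ne hpq.ne
    with ⟨hrs, hrp, -⟩ | ⟨hrs, hrq, -⟩ | ⟨hrp, hrq, -⟩
  · exact inE_of_diamond hconn hG.2.2 hs hp h1 h2 hrs.symm h3 hrp.symm hqr
  · exact inE_of_diamond hconn hG.2.2 hs hq h2 h1 hrs.symm h3.symm hrq.symm hpr
  · exact inE_of_diamond hconn hG.2.2 hp hq h3 h1.symm hrp.symm h2.symm hrq.symm hsr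

lemma cliqueFree_core (hconn : G.Connected) (hG : InC G) (hE : ¬ InE G) :
    (core G).CliqueFree 4 := by
  refine cliqueFree_four_iff.2 fun a b c d hab hac had hbc hbd hcd => hE ?_
  rcases exists_triangle_of_core_adj hG.1 hG.2.1 hab hac had hbc.ne hbd.ne hcd.ne
    with ⟨h1, h2, h3⟩ | ⟨h1, h2, h3⟩ | ⟨h1, h2, h3⟩
  · exact inE_of_core_clique hconn hG hab hac had hbc hbd hcd h1 h2 h3
  · exact inE_of_core_clique hconn hG hab had hac hbd hbc hcd.symm h1 h2 h3
  · exact inE_of_core_clique hconn hG hac had hab hcd hbc.symm hbd.symm h1 h2 h3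

end SubdividedK4

/-! ### Dynamic colorings -/

section Dynamic

variable {V : Type*} {G : SimpleGraph V}

/-- `f` is a proper coloring as far as the edges at `v` are concerned, and if `v` has degree 2, then
its neighbors get different colors. -/
def IsDynamicAt (G : SimpleGraph V) (f : V → ZMod 3) (v : V) : Prop :=
  (∀ w, G.Adj v w → f v ≠ f w) ∧
    (deg G v = 2 → ∀ a b, G.Adj v a → G.Adj v b → a ≠ b → f a ≠ f b)

lemma IsDynamicAt.congr {f g : V → ZMod 3} {v : V} (hg : IsDynamicAt G g v) (hv : f v = g v)
    (hnbr : ∀ w, G.Adj v w → f w = g w) : IsDynamicAt G f v := by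
  refine ⟨fun w hw => ?_, fun hd a b ha hb hab => ?_⟩
  · rw [hv, hnbr w hw]
    exact hg.1 w hw
  · rw [hnbr a ha, hnbr b hb]
    exact hg.2 hd a b ha hb hab

variable [Finite V]

lemma dynThreeColorable_of_coloring [Nonempty V] (c : V → Fin 3)
    (hc : ∀ u v, G.Adj u v → c u ≠ c v)
    (hdyn : ∀ v, 2 ≤ deg G v → ∃ a b, G.Adj v a ∧ G.Adj v b ∧ c a ≠ c b) :
    DynThreeColorable G := by
  classical
  -- Unused colors are left out to make the coloring surjective.
  let e := Fintype.equivFin (Set.range c)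
  have hcard : Fintype.card (Set.range c) ≤ 3 :=
    (Fintype.card_subtype_le (· ∈ Set.range c)).trans (Fintype.card_fin 3).le
  have hpos : 0 < Fintype.card (Set.range c) :=
    Fintype.card_pos_iff.2 (Set.range_nonempty c).to_subtype
  let c' : V → Fin (Fintype.card (Set.range c)) := fun v => e ⟨c v, v, rfl⟩
  have hne : ∀ u v, c u ≠ c v → c' u ≠ c' v := fun u v h h' =>
    h (congrArg Subtype.val (e.injective h'))
  refine ⟨_, hpos, hcard, c', ?_, fun u v h => hne u v (hc u v h), fun v => ?_⟩
  · intro k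
    obtain ⟨⟨_, v, rfl⟩, rfl⟩ := e.surjective k
    exact ⟨v, rfl⟩
  · by_cases hd : 2 ≤ deg G v
    · obtain ⟨a, b, ha, hb, hab⟩ := hdyn v hd
      refine (min_le_right _ _).trans ?_
      rw [← Set.ncard_pair (hne a b hab)]
      refine Set.ncard_le_ncard ?_ (Set.toFinite _)
      rintro x (rfl | rfl)
      exacts [⟨a, ha, rfl⟩, ⟨b, hb, rfl⟩]
    · refine (min_le_left _ _).trans ?_
      rcases Nat.eq_zero_or_pos (deg G v) with h | h
      · omega
      · obtain ⟨w, hw⟩ := deg_pos_iff.1 h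
        have : 0 < (c' '' G.neighborSet v).ncard :=
          (Set.ncard_pos (Set.toFinite _)).2 ⟨c' w, w, hw, rfl⟩
        omega

lemma IsThread.exists_nbr {x : ℕ → V} {k m : ℕ} (hmax : ∀ v, deg G v ≤ 3) (hx : IsThread G x k)
    (hk : 0 < k) (h0 : deg G (x 0) ≠ 2) (hk' : deg G (x k) ≠ 2) (hm : m ≤ k)
    (h3 : deg G (x m) ≠ 3) {w : V} (hw : G.Adj (x m) w) :
    ∃ l, l ≤ k ∧ x l = w ∧ (l = m + 1 ∨ m = l + 1) := by
  have h := hmax (x m)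
  by_cases hm0 : m = 0
  · subst hm0
    exact ⟨1, hk, (eq_of_deg_le_one (by omega) (hx.1 0 hk) hw).symm, Or.inl rfl⟩
  obtain ⟨m, rfl⟩ := Nat.exists_eq_add_one_of_ne_zero (n := m) (by omega)
  by_cases hmk : m + 1 = k
  · subst hmk
    exact ⟨m, by omega, (eq_of_deg_le_one (by omega) (hx.1 m (by omega)).symm hw).symm, Or.inr rfl⟩
  · rcases hx.eq_or_eq (by omega) hw with h | h
    · exact ⟨m, by omega, h.symm, Or.inr rfl⟩
    · exact ⟨m + 2, by omega, h.symm, Or.inl rfl⟩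

lemma exists_slope_zmod :
    ∀ p q r : ZMod 3, p ≠ q → r ≠ 0 → ∃ d : ZMod 3, d ≠ 0 ∧ q = p + d * r := by
  decide

lemma IsThread.exists_slope {x : ℕ → V} {k : ℕ} (hG : InC G) (hx : IsThread G x k) {c : V → ZMod 3}
    (hc : ∀ u v, (core G).Adj u v → c u ≠ c v) :
    ∃ a d : ZMod 3, d ≠ 0 ∧ (deg G (x 0) = 3 → c (x 0) = a) ∧
      (deg G (x k) = 3 → c (x k) = a + d * (k : ZMod 3)) := by
  by_cases h0 : deg G (x 0) = 3
  swap
  · exact ⟨c (x k) - (k : ZMod 3), 1, by decide, fun h => absurd h h0, fun _ => by simp⟩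
  by_cases hk : deg G (x k) = 3
  swap
  · exact ⟨c (x 0), 1, by decide, fun _ => rfl, fun h => absurd h hk⟩
  by_cases hne : x 0 = x k
  · refine ⟨c (x 0), 1, by decide, fun _ => rfl, fun _ => ?_⟩
    have : (k : ZMod 3) = 0 := by
      rcases Nat.eq_zero_or_pos k with rfl | hpos
      · rfl
      · rw [hx.length_eq_three hG.2.1 hpos hne h0]; rfl
    rw [this, ← hne]
    simp
  · have h1 := hx.mod_three_ne_zero hG.2.2 h0 hk hne
    have h2 : (k : ZMod 3) ≠ 0 := fun h =>
      h1 (Nat.mod_eq_zero_of_dvd ((ZMod.natCast_eq_zero_iff k 3).1 h))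
    obtain ⟨d, hd, he⟩ := exists_slope_zmod (c (x 0)) (c (x k)) k
      (hc _ _ ⟨hne, h0, hk, x, k, hx, rfl, rfl⟩) h2
    exact ⟨c (x 0), d, hd, fun _ => rfl, fun _ => he⟩

lemma IsThread.exists_coloring {x : ℕ → V} {k : ℕ} (hG : InC G) (hx : IsThread G x k)
    (h0 : deg G (x 0) ≠ 2) (hk : deg G (x k) ≠ 2) {c : V → ZMod 3}
    (hc : ∀ u v, (core G).Adj u v → c u ≠ c v) :
    ∃ (g : V → ZMod 3) (a d : ZMod 3), d ≠ 0 ∧ (∀ v, deg G v = 3 → g v = c v) ∧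
      ∀ m ≤ k, g (x m) = a + d * (m : ZMod 3) := by
  classical
  obtain ⟨a, d, hd, ha0, hak⟩ := hx.exists_slope hG hc
  let idx : V → ℕ := fun v => if h : ∃ m ≤ k, x m = v then h.choose else 0
  refine ⟨fun v => if deg G v = 3 then c v else a + d * (idx v : ZMod 3), a, d, hd,
    fun v hv => if_pos hv, fun m hm => ?_⟩
  by_cases h3 : deg G (x m) = 3
  · simp only [if_pos h3]
    rcases Nat.eq_zero_or_pos m with rfl | hm0
    · simpa using ha0 h3
    rcases hm.eq_or_lt with rfl | hmk
    · exact hak h3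
    · obtain ⟨m, rfl⟩ := Nat.exists_eq_add_one_of_ne_zero hm0.ne'
      have hd2 := (hx.2 m hmk).1
      omega
  · have hex : ∃ m' ≤ k, x m' = x m := ⟨m, hm, rfl⟩
    have hidx : idx (x m) % 3 = m % 3 := by
      rw [show idx (x m) = hex.choose from dif_pos hex]
      exact hx.mod_three_eq hG.1 hG.2.1 h0 hk hex.choose_spec.1 hm hex.choose_spec.2
    simp only [if_neg h3, (ZMod.natCast_eq_natCast_iff' _ _ 3).2 hidx]

lemma IsThread.isDynamicAt {x : ℕ → V} {k m : ℕ} (hmax : ∀ v, deg G v ≤ 3) (hx : IsThread G x k)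
    (hk : 0 < k) (h0 : deg G (x 0) ≠ 2) (hk' : deg G (x k) ≠ 2) {g : V → ZMod 3} {a d : ZMod 3}
    (hd : d ≠ 0) (hg : ∀ m ≤ k, g (x m) = a + d * (m : ZMod 3)) (hm : m ≤ k)
    (h3 : deg G (x m) ≠ 3) : IsDynamicAt G g (x m) := by
  have hnbr : ∀ w, G.Adj (x m) w → ∃ l ≤ k, x l = w ∧ (l = m + 1 ∨ m = l + 1) := fun w hw =>
    hx.exists_nbr hmax hk h0 hk' hm h3 hw
  have hstep : ∀ p q : ℕ, p ≤ k → q ≤ k → (q = p + 1 ∨ q = p + 2) → g (x p) ≠ g (x q) := by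
    intro p q hp hq hpq
    have key : ∀ a d m : ZMod 3, d ≠ 0 → a + d * m ≠ a + d * (m + 1) ∧
      a + d * m ≠ a + d * (m + 2) := by decide
    rw [hg p hp, hg q hq]
    rcases hpq with rfl | rfl <;> push_cast
    exacts [(key _ _ _ hd).1, (key _ _ _ hd).2]
  refine ⟨fun w hw => ?_, fun _ u v hu hv huv => ?_⟩
  · obtain ⟨l, hl, rfl, hlm | hlm⟩ := hnbr w hw
    exacts [hstep m l hm hl (.inl hlm), (hstep l m hl hm (.inl hlm)).symm]
  · obtain ⟨p, hp, rfl, hpm | hpm⟩ := hnbr u hu <;> obtain ⟨q, hq, rfl, hqm | hqm⟩ := hnbr v hv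
    · exact absurd (by rw [hpm, hqm]) huv
    · exact (hstep q p hq hp (by omega)).symm
    · exact hstep p q hp hq (by omega)
    · exact absurd (by rw [show p = q by omega]) huv

lemma exists_local_coloring [Nontrivial V] (hconn : G.Connected) (hG : InC G) {v₀ : V}
    (h₀ : deg G v₀ ≠ 2) {c : V → ZMod 3} (hc : ∀ u v, (core G).Adj u v → c u ≠ c v) (y : V) :
    ∃ g : V → ZMod 3, (∀ v, deg G v = 3 → g v = c v) ∧
      ∀ z, deg G z ≠ 3 → (isolate G {v | deg G v = 3}).Reachable y z → IsDynamicAt G g z := by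
  obtain ⟨x, k, m, hx, hx0, hxk, hk, hm, rfl⟩ := exists_thread_through hconn h₀ y
  obtain ⟨g, a, d, hd, hgc, hg⟩ := hx.exists_coloring hG hx0 hxk hc
  refine ⟨g, hgc, fun z hz hyz => ?_⟩
  suffices hmem : ∃ l ≤ k, x l = z by
    obtain ⟨l, hl, rfl⟩ := hmem
    exact hx.isDynamicAt hG.1 hk hx0 hxk hd hg hl hz
  rw [SimpleGraph.reachable_iff_reflTransGen] at hyz
  clear hz
  induction hyz with
  | refl => exact ⟨m, hm, rfl⟩
  | tail _ hadj ih =>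
    obtain ⟨l, hl, rfl⟩ := ih
    obtain ⟨l', hl', he, -⟩ := hx.exists_nbr hG.1 hk hx0 hxk hl hadj.2.1 hadj.1
    exact ⟨l', hl', he⟩

lemma exists_coloring_of_core [Nontrivial V] (hconn : G.Connected) (hG : InC G) {v₀ : V}
    (h₀ : deg G v₀ ≠ 2) {c : V → ZMod 3} (hc : ∀ u v, (core G).Adj u v → c u ≠ c v) :
    ∃ f : V → ZMod 3, (∀ v, deg G v = 3 → f v = c v) ∧ ∀ v, deg G v ≠ 3 → IsDynamicAt G f v := by
  classical
  choose g hgc hg using exists_local_coloring hconn hG h₀ hc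
  -- The components of `L` are the interiors of the threads; each is colored by itself.
  let L := isolate G {v | deg G v = 3}
  let rep : V → V := fun v => (L.connectedComponentMk v).out
  have reachable_rep : ∀ v, L.Reachable (rep v) v := fun v =>
    SimpleGraph.ConnectedComponent.exact (Quot.out_eq (L.connectedComponentMk v))
  have rep_eq : ∀ v w, L.Adj v w → rep v = rep w := fun v w h =>
    congrArg Quot.out (SimpleGraph.ConnectedComponent.sound h.reachable)
  refine ⟨fun v => if deg G v = 3 then c v else g (rep v) v, fun v hv => if_pos hv,
    fun v hv => (hg (rep v) v hv (reachable_rep v)).congr (if_neg hv) fun w hw => ?_⟩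
  by_cases hw3 : deg G w = 3
  · simp only [if_pos hw3, hgc _ _ hw3]
  · simp only [if_neg hw3, rep_eq v w ⟨hw, hv, hw3⟩]

theorem dynThreeColorable_of_not_inE (hconn : G.Connected) (hG : InC G)
    (h2 : ¬ ∀ v, deg G v = 2) (hE : ¬ InE G) : DynThreeColorable G := by
  have := hconn.nonempty
  rcases subsingleton_or_nontrivial V with hV | hV
  · have hnadj : ∀ u v, ¬ G.Adj u v := fun u v huv => huv.ne (Subsingleton.elim u v)
    refine dynThreeColorable_of_coloring (fun _ => 0) (fun u v huv => absurd huv (hnadj u v))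
      fun v hv => ?_
    obtain ⟨w, hw⟩ := deg_pos_iff.1 (show 0 < deg G v by omega)
    exact absurd hw (hnadj v w)
  obtain ⟨v₀, h₀⟩ := not_forall.1 h2
  obtain ⟨c⟩ := (clawFree_core hG.1 hG.2.1).colorable_three (deg_core_le hG.1)
    (cliqueFree_core hconn hG hE)
  have hc : ∀ u v, (core G).Adj u v → c u ≠ c v := fun _ _ => c.valid
  obtain ⟨f, hfc, hf⟩ := exists_coloring_of_core hconn hG h₀ hc
  have hproper : ∀ u v, G.Adj u v → f u ≠ f v := by
    intro u v huv
    by_cases hu : deg G u = 3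
    · by_cases hv : deg G v = 3
      · rw [hfc u hu, hfc v hv]
        exact hc u v (core_adj_of_adj huv hu hv)
      · exact ((hf v hv).1 u huv.symm).symm
    · exact (hf u hu).1 v huv
  refine dynThreeColorable_of_coloring f hproper fun v hv => ?_
  by_cases hd : deg G v = 2
  · obtain ⟨a, ha⟩ := deg_pos_iff.1 (show 0 < deg G v by omega)
    obtain ⟨b, hba, hb⟩ := exists_ne_of_deg_two hd a
    exact ⟨b, a, hb, ha, (hf v (by omega)).2 hd b a hb ha hba⟩
  · have h3 := hG.1 v
    obtain ⟨a, b, -, -, -, ha, hb, hab, -⟩ := hG.2.1.exists_triangle (v := v) (by omega)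
    exact ⟨a, b, ha, hb, hproper a b hab⟩

end Dynamic

/-! ### The exceptional graphs -/

section

variable {V W : Type*} {G : SimpleGraph V} {K : SimpleGraph W} {x : ℕ → V} {k : ℕ}

lemma deg_iso (e : G ≃g K) (v : V) : deg K (e v) = deg G v :=
  (Nat.card_congr (e.mapNeighborSet v)).symm

lemma DynThreeColorable.exists_coloring [Finite V] (h : DynThreeColorable G) :
    ∃ c : V → Fin 3, (∀ u v, G.Adj u v → c u ≠ c v) ∧
      ∀ v, 2 ≤ deg G v → ∃ a b, G.Adj v a ∧ G.Adj v b ∧ c a ≠ c b := by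
  obtain ⟨k, -, hk, c, -, hc, hd⟩ := h
  refine ⟨fun v => Fin.castLE hk (c v), fun u v huv h => hc u v huv (Fin.castLE_injective hk h),
    fun v hv => ?_⟩
  have h2 := hd v
  rw [min_eq_right hv] at h2
  obtain ⟨_, ⟨a, ha, rfl⟩, _, ⟨b, hb, rfl⟩, hab⟩ := (Set.one_lt_ncard (Set.toFinite _)).1 h2
  exact ⟨a, b, ha, hb, fun h => hab (Fin.castLE_injective hk h)⟩

lemma eq_of_ne_of_ne_of_ne {p q r s : Fin 3} (hqr : q ≠ r) (hpq : p ≠ q) (hpr : p ≠ r)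
    (hsq : s ≠ q) (hsr : s ≠ r) : s = p := by
  omega

lemma IsThread.color_ne_color_add_two [Finite V] (hx : IsThread G x k) {c : V → Fin 3}
    (hdyn : ∀ v, 2 ≤ deg G v → ∃ a b, G.Adj v a ∧ G.Adj v b ∧ c a ≠ c b) {m : ℕ}
    (hm : m + 1 < k) : c (x m) ≠ c (x (m + 2)) := by
  obtain ⟨a, b, ha, hb, hab⟩ := hdyn _ (hx.2 m hm).1.ge
  rcases hx.eq_or_eq hm ha with rfl | rfl <;> rcases hx.eq_or_eq hm hb with rfl | rfl
  exacts [absurd rfl hab, hab, hab.symm, absurd rfl hab]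

lemma IsThread.color_eq_color_mod_three [Finite V] (hx : IsThread G x k) {c : V → Fin 3}
    (hc : ∀ u v, G.Adj u v → c u ≠ c v)
    (hdyn : ∀ v, 2 ≤ deg G v → ∃ a b, G.Adj v a ∧ G.Adj v b ∧ c a ≠ c b) {m : ℕ} (hm : m ≤ k) :
    c (x m) = c (x (m % 3)) := by
  have hone : ∀ l < k, c (x l) ≠ c (x (l + 1)) := fun l hl => hc _ _ (hx.1 l hl)
  have htwo : ∀ l, l + 1 < k → c (x l) ≠ c (x (l + 2)) := fun l hl =>
    hx.color_ne_color_add_two hdyn hl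
  induction m using Nat.strong_induction_on with
  | _ m ih =>
    rcases lt_or_ge m 3 with h3 | h3
    · rw [Nat.mod_eq_of_lt h3]
    · obtain ⟨l, rfl⟩ := Nat.exists_eq_add_of_le' h3
      rw [Nat.add_mod_right, ← ih l (by omega) (by omega)]
      exact eq_of_ne_of_ne_of_ne (hone (l + 1) (by omega)) (hone l (by omega)) (htwo l (by omega))
        (htwo (l + 1) (by omega)).symm (hone (l + 2) (by omega)).symm

lemma IsThread.color_ne_color_of_mod_three_ne_zero [Finite V] (hx : IsThread G x k)
    {c : V → Fin 3} (hc : ∀ u v, G.Adj u v → c u ≠ c v)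
    (hdyn : ∀ v, 2 ≤ deg G v → ∃ a b, G.Adj v a ∧ G.Adj v b ∧ c a ≠ c b) (hk : k % 3 ≠ 0) :
    c (x 0) ≠ c (x k) := by
  rw [hx.color_eq_color_mod_three hc hdyn le_rfl]
  obtain h | h : k % 3 = 1 ∨ k % 3 = 2 := by omega
  · rw [h]
    exact hc _ _ (hx.1 0 (by omega))
  · rw [h]
    exact hx.color_ne_color_add_two hdyn (by omega)

/-- A vertex of degree 3 all of whose neighbors have degree 3. -/
def IsFull (G : SimpleGraph V) (v : V) : Prop := deg G v = 3 ∧ ∀ w, G.Adj v w → deg G w = 3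

end

section K4Path

lemma deg_k4Path_inr {k : ℕ} (hk : 0 < k) (s : Fin 2) : deg (k4Path (k + 1)) (.inr s) = 3 := by
  refine deg_eq_three_of_nbrs (a := .inr (1 - s)) (b := .inl 0) (c := .inl (Fin.last k))
    (by simp) (by simp) (by simp [Fin.ext_iff]; omega) ?_
  rintro (m | t)
  · simp only [k4Path_adj_inr_inl, Sum.inl.injEq, Fin.ext_iff, Fin.val_zero, Fin.val_last,
      reduceCtorEq, false_or]
    omega
  · simp only [k4Path_adj_inr, Sum.inr.injEq, reduceCtorEq, or_false]
    revert s t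
    decide

lemma deg_k4Path_zero {k : ℕ} (hk : 0 < k) : deg (k4Path (k + 1)) (.inl 0) = 3 := by
  refine deg_eq_three_of_nbrs (a := .inr 0) (b := .inr 1) (c := .inl ⟨1, by omega⟩)
    (by simp) (by simp) (by simp) ?_
  rintro (m | t)
  · simp only [k4Path_adj_inl, Fin.val_zero, reduceCtorEq, Sum.inl.injEq, Fin.ext_iff, false_or,
      or_false]
    omega
  · simp only [k4Path_adj_inl_inr, Fin.val_zero, true_or, true_iff, Sum.inr.injEq, reduceCtorEq,
      or_false]
    revert t
    decide

lemma deg_k4Path_last {k : ℕ} (hk : 0 < k) : deg (k4Path (k + 1)) (.inl (Fin.last k)) = 3 := by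
  refine deg_eq_three_of_nbrs (a := .inr 0) (b := .inr 1) (c := .inl ⟨k - 1, by omega⟩)
    (by simp) (by simp) (by simp) ?_
  rintro (m | t)
  · have := m.2
    simp only [k4Path_adj_inl, Fin.val_last, reduceCtorEq, Sum.inl.injEq, Fin.ext_iff, false_or]
    omega
  · simp only [k4Path_adj_inl_inr, Fin.val_last, or_true, true_iff, Sum.inr.injEq, reduceCtorEq,
      or_false]
    revert t
    decide

lemma deg_k4Path_internal {k m : ℕ} (hm : m + 1 < k) :
    deg (k4Path (k + 1)) (.inl ⟨m + 1, by omega⟩) = 2 := by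
  refine deg_eq_two_of_nbrs (a := .inl ⟨m, by omega⟩) (b := .inl ⟨m + 2, by omega⟩) (by simp) ?_
  rintro (l | t)
  · simp only [k4Path_adj_inl, Sum.inl.injEq, Fin.ext_iff]
    omega
  · simp [k4Path_adj_inl_inr, hm.ne]

-- The path is continued by its last vertex, to have a thread indexed by `ℕ`.
lemma isSubdividedK4_k4Path {k : ℕ} (hk : 0 < k) :
    IsSubdividedK4 (k4Path (k + 1)) (fun m => .inl ⟨min m k, by omega⟩) k .inr where
  isThread := by
    refine ⟨fun m hm => k4Path_adj_inl.2 (.inl (by simp only; omega)), fun m hm => ⟨?_, ?_⟩⟩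
    · simp only [Nat.min_eq_left (show m + 1 ≤ k by omega)]
      exact deg_k4Path_internal hm
    · simp only [ne_eq, Sum.inl.injEq, Fin.ext_iff]
      omega
  start_ne_end := by simp [hk.ne']
  adj _ _ := k4Path_adj_inr.2
  adj_start _ := k4Path_adj_inr_inl.2 (.inl (by simp))
  adj_end _ := k4Path_adj_inr_inl.2 (.inr (by simp))
  deg_start := by simpa using deg_k4Path_zero hk
  deg_end := by simpa only [min_self] using! deg_k4Path_last hk
  deg_apex := deg_k4Path_inr hk

end K4Path

namespace IsSubdividedK4

variable {V W : Type*} {G : SimpleGraph V} {K : SimpleGraph W} {x : ℕ → V} {k : ℕ} {y : Fin 2 → V}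

lemma map_iso (h : IsSubdividedK4 G x k y) (e : G ≃g K) :
    IsSubdividedK4 K (e ∘ x) k (e ∘ y) where
  isThread := ⟨fun m hm => e.map_adj_iff.2 (h.isThread.1 m hm), fun m hm =>
    ⟨(deg_iso e _).trans (h.isThread.2 m hm).1, e.injective.ne (h.isThread.2 m hm).2⟩⟩
  start_ne_end := e.injective.ne h.start_ne_end
  adj s t hst := e.map_adj_iff.2 (h.adj s t hst)
  adj_start s := e.map_adj_iff.2 (h.adj_start s)
  adj_end s := e.map_adj_iff.2 (h.adj_end s)
  deg_start := (deg_iso e _).trans h.deg_start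
  deg_end := (deg_iso e _).trans h.deg_end
  deg_apex s := (deg_iso e _).trans (h.deg_apex s)

variable [Finite V] (h : IsSubdividedK4 G x k y)
include h

lemma not_dynThreeColorable (hk : k % 3 ≠ 0) : ¬ DynThreeColorable G := by
  intro hdyn
  obtain ⟨c, hc, hd⟩ := hdyn.exists_coloring
  exact h.isThread.color_ne_color_of_mod_three_ne_zero hc hd hk
    (eq_of_ne_of_ne_of_ne (hc _ _ (h.adj 0 1 (by decide))) (hc _ _ (h.adj_end 0)).symm
      (hc _ _ (h.adj_end 1)).symm (hc _ _ (h.adj_start 0)).symm (hc _ _ (h.adj_start 1)).symm)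

lemma isFull (s : Fin 2) : IsFull G (y s) := by
  refine ⟨h.deg_apex s, fun w hw => ?_⟩
  rcases h.eq_of_adj_apex hw with rfl | rfl | rfl
  exacts [h.deg_apex _, h.deg_start, h.deg_end]

lemma two_le_ncard_isFull : 2 ≤ {v | IsFull G v}.ncard := by
  rw [← Set.ncard_pair (h.adj 0 1 (by decide)).ne]
  exact Set.ncard_le_ncard (Set.pair_subset (h.isFull 0) (h.isFull 1)) (Set.toFinite _)

end IsSubdividedK4

section Exceptional

variable {V : Type*} {G : SimpleGraph V}

lemma InE.exists_isSubdividedK4 (hE : InE G) :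
    ∃ x k y, IsSubdividedK4 G x k y ∧ k % 3 ≠ 0 ∧ ∀ v, (∃ m ≤ k, x m = v) ∨ ∃ s, y s = v := by
  obtain ⟨i, j, hj, hij, ⟨e⟩⟩ := hE
  obtain ⟨k, rfl⟩ := Nat.exists_eq_add_one_of_ne_zero (n := i) (by omega)
  refine ⟨_, k, _, (isSubdividedK4_k4Path (by omega)).map_iso e.symm, by omega, fun v => ?_⟩
  obtain ⟨m | s, rfl⟩ := e.symm.surjective v
  · exact .inl ⟨m, by omega, by simp [show min m.val k = m by omega]⟩
  · exact .inr ⟨s, rfl⟩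

lemma InE.deg_eq_two_or_three (hE : InE G) (v : V) : deg G v = 2 ∨ deg G v = 3 := by
  obtain ⟨x, k, y, h, -, hcover⟩ := hE.exists_isSubdividedK4
  obtain ⟨m, hm, rfl⟩ | ⟨s, rfl⟩ := hcover v
  · rcases Nat.eq_zero_or_pos m with rfl | hm0
    · exact .inr h.deg_start
    rcases hm.eq_or_lt with rfl | hmk
    · exact .inr h.deg_end
    obtain ⟨m, rfl⟩ := Nat.exists_eq_add_one_of_ne_zero hm0.ne'
    exact .inl (h.isThread.2 m hmk).1
  · exact .inr (h.deg_apex s)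

lemma InE.ncard_deg_three (hE : InE G) : {v | deg G v = 3}.ncard = 4 := by
  obtain ⟨x, k, y, h, -, hcover⟩ := hE.exists_isSubdividedK4
  refine Set.ncard_eq_four.2 ⟨x 0, x k, y 0, y 1, h.start_ne_end, (h.adj_start 0).ne.symm,
    (h.adj_start 1).ne.symm, (h.adj_end 0).ne.symm, (h.adj_end 1).ne.symm,
    (h.adj 0 1 (by decide)).ne, Set.ext fun v => ⟨fun hv => ?_, ?_⟩⟩
  · obtain ⟨m, hm, rfl⟩ | ⟨s, rfl⟩ := hcover v
    · by_cases hm0 : m = 0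
      · simp [hm0]
      by_cases hmk : m = k
      · simp [hmk]
      obtain ⟨m, rfl⟩ := Nat.exists_eq_add_one_of_ne_zero hm0
      have := (h.isThread.2 m (by omega)).1.symm.trans hv
      omega
    · fin_cases s <;> simp
  · rintro (rfl | rfl | rfl | rfl)
    exacts [h.deg_start, h.deg_end, h.deg_apex 0, h.deg_apex 1]

variable [Finite V]

theorem dynThreeColorable_iff_determinationAnswer (hconn : G.Connected) (hG : InC G)
    (h2 : ¬ ∀ v, deg G v = 2) : DynThreeColorable G ↔ DeterminationAnswer G := by
  refine ⟨fun h => .inr (.inr fun hE => ?_), fun h =>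
    dynThreeColorable_of_not_inE hconn hG h2 fun hE => ?_⟩
  · obtain ⟨x, k, y, hK4, hk, -⟩ := hE.exists_isSubdividedK4
    exact hK4.not_dynThreeColorable hk h
  · rcases h with ⟨v, hv⟩ | h | h
    · have := hE.deg_eq_two_or_three v
      omega
    · exact h hE.ncard_deg_three
    · exact h hE

lemma IsFull.adj (h4 : {v | deg G v = 3}.ncard = 4) {v w : V} (hv : IsFull G v)
    (hw : deg G w = 3) (hwv : w ≠ v) : G.Adj v w := by
  have hsub : G.neighborSet v ⊆ {v | deg G v = 3} \ {v} := fun w hw => ⟨hv.2 w hw, hw.ne.symm⟩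
  have hcard : ({v | deg G v = 3} \ {v}).ncard = 3 := by
    rw [Set.ncard_sdiff_singleton_of_mem (show v ∈ {v | deg G v = 3} from hv.1), h4]
  exact (Set.eq_of_subset_of_ncard_le hsub (hcard.le.trans hv.1.ge)).ge ⟨hw, hwv⟩

lemma core_adj_of_isFull (hmax : ∀ v, deg G v ≤ 3) (hleaf : ∀ v, deg G v ≠ 1) {a b u v : V}
    (hab : a ≠ b) (huv : u ≠ v) (ha : IsFull G a) (hb : IsFull G b) (hua : G.Adj u a)
    (hub : G.Adj u b) (h3 : ∀ w, deg G w = 3 ↔ w = a ∨ w = b ∨ w = u ∨ w = v) :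
    (core G).Adj u v := by
  have hu : deg G u = 3 := (h3 u).2 (by simp)
  obtain ⟨c, hca, hcb, huc, hall⟩ := exists_third_of_deg_three hu hua hub hab
  obtain ⟨k, hk, hx, hend⟩ := exists_track_end huc (by omega)
  have hx0 : track G u c 0 = u := track_zero u c
  have hx1 : track G u c 1 = c := track_one u c
  have hret := hx.second_ne_penultimate hk
  have hlast := hx.adj_last hk
  set x := track G u c
  have hlength : deg G (x (k - 1)) = 3 → x k = c := by
    intro hd
    obtain rfl : k = 1 := by
      by_contra h
      have := (hx.2 (k - 2) (by omega)).1
      rw [show k - 2 + 1 = k - 1 by omega] at this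
      omega
    exact hx1
  have hk3 : deg G (x k) = 3 := by
    have := hmax (x k)
    have := hleaf (x k)
    have := deg_pos_iff.2 ⟨_, hlast⟩
    omega
  rcases (h3 _).1 hk3 with h | h | h | h
  · exact absurd ((hlength (ha.2 _ (h ▸ hlast))).symm.trans h) hca
  · exact absurd ((hlength (hb.2 _ (h ▸ hlast))).symm.trans h) hcb
  · rw [h] at hlast
    rcases hall _ hlast with h' | h' | h'
    · exact absurd (h.symm.trans (hlength (h' ▸ ha.1))) huc.ne
    · exact absurd (h.symm.trans (hlength (h' ▸ hb.1))) huc.ne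
    · exact absurd (hx1.trans h'.symm) (hret (hx0.trans h.symm))
  · exact ⟨huv, hu, (h3 v).2 (by simp), x, k, hx, hx0, h⟩

lemma inE_of_two_le_ncard_isFull (hconn : G.Connected) (hG : InC G)
    (hleaf : ∀ v, deg G v ≠ 1) (h4 : {v | deg G v = 3}.ncard = 4)
    (hfull : 2 ≤ {v | IsFull G v}.ncard) : InE G := by
  obtain ⟨a, ha, b, hb, hab⟩ := (Set.one_lt_ncard (Set.toFinite _)).1 hfull
  have hsub : {a, b} ⊆ {v | deg G v = 3} := Set.pair_subset ha.1 hb.1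
  obtain ⟨u, v, huv, hD⟩ := Set.ncard_eq_two.1 (show ({v | deg G v = 3} \ {a, b}).ncard = 2 by
    rw [Set.ncard_sdiff hsub, h4, Set.ncard_pair hab])
  have h3 : ∀ w, deg G w = 3 ↔ w = a ∨ w = b ∨ w = u ∨ w = v := fun w => by
    rw [← or_assoc]
    exact Set.ext_iff.1 ((Set.union_sdiff_cancel hsub).symm.trans (congrArg _ hD)) w
  obtain ⟨hu, hua⟩ := hD.ge (Set.mem_insert u {v})
  obtain ⟨hv, hva⟩ := hD.ge (Set.mem_insert_of_mem u rfl)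
  simp only [Set.mem_insert_iff, Set.mem_singleton_iff, not_or] at hua hva
  have hau := ha.adj h4 hu hua.1
  have hbu := hb.adj h4 hu hua.2
  exact inE_of_diamond hconn hG.2.2 ha.1 hb.1 (ha.adj h4 hb.1 hab.symm) hau
    (ha.adj h4 hv hva.1) hbu (hb.adj h4 hv hva.2)
    (core_adj_of_isFull hG.1 hleaf hab huv ha hb hau.symm hbu.symm h3)

lemma determinationAnswer_iff (hconn : G.Connected) (hG : InC G) :
    DeterminationAnswer G ↔ (∃ v, deg G v = 1) ∨ {v | deg G v = 3}.ncard ≠ 4 ∨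
      {v | IsFull G v}.ncard < 2 := by
  rw [DeterminationAnswer]
  by_cases hleaf : ∃ v, deg G v = 1
  · simp [hleaf]
  by_cases h4 : {v | deg G v = 3}.ncard = 4
  · simp only [hleaf, h4, ne_eq, not_true, false_or, ← not_le]
    refine not_congr ⟨fun hE => ?_, inE_of_two_le_ncard_isFull hconn hG (not_exists.1 hleaf) h4⟩
    obtain ⟨x, k, y, h, -⟩ := hE.exists_isSubdividedK4
    exact h.two_le_ncard_isFull
  · simp [h4]

end Exceptional

/-! ### Cycles -/

section Cycles

variable {V : Type*} [Finite V] {G : SimpleGraph V}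

lemma exists_track_eq_start (h2 : ∀ v, deg G v = 2) {u w : V} (huw : G.Adj u w) :
    ∃ n, track G u w (n + 3) = u ∧ Set.InjOn (track G u w) {m | m < n + 3} := by
  classical
  have hx : ∀ k, IsThread G (track G u w) k := fun k => isThread_track huw fun m _ => h2 _
  have hstart := track_zero (G := G) u w
  set x := track G u w
  have hadj : ∀ m, G.Adj (x m) (x (m + 1)) := fun m => (hx (m + 1)).1 m (by omega)
  have hne2 : ∀ m, x m ≠ x (m + 2) := fun m => ((hx (m + 2)).2 m (by omega)).2
  have hex : ∃ j, ∃ i < j, x i = x j := by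
    obtain ⟨i, j, hij, he⟩ := Finite.exists_ne_map_eq_of_infinite x
    rcases lt_or_gt_of_ne hij with h | h
    exacts [⟨j, i, h, he⟩, ⟨i, j, h, he.symm⟩]
  obtain ⟨N, ⟨i, hiN, hi⟩, hmin⟩ : ∃ N, (∃ i < N, x i = x N) ∧ ∀ j < N, ¬ ∃ i < j, x i = x j :=
    ⟨Nat.find hex, Nat.find_spec hex, fun j hj => Nat.find_min hex hj⟩
  have hinj : Set.InjOn x {m | m < N} := fun i hi j hj he => by
    rcases lt_trichotomy i j with h | h | h
    exacts [absurd ⟨i, h, he⟩ (hmin j hj), h, absurd ⟨j, h, he.symm⟩ (hmin i hi)]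
  -- `x i` with `i > 0` has no room for another neighbor before `x N`.
  obtain rfl : i = 0 := by
    by_contra hi0
    obtain ⟨i, rfl⟩ := Nat.exists_eq_add_one_of_ne_zero hi0
    obtain ⟨N, rfl⟩ := Nat.exists_eq_add_one_of_ne_zero (n := N) (by omega)
    rcases (hx (i + 2)).eq_or_eq (by omega) (hi ▸ (hadj N).symm) with h | h
    · have := hinj (by simp) (show i < N + 1 by omega) h
      omega
    · rcases (show i + 2 ≤ N + 1 by omega).eq_or_lt with hlt | hlt
      · exact (hadj N).ne (by rw [h, hlt])
      · obtain rfl := hinj (by simp) hlt h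
        exact hne2 (i + 1) hi
  have hN1 : N ≠ 1 := by rintro rfl; exact (hadj 0).ne hi
  have hN2 : N ≠ 2 := by rintro rfl; exact hne2 0 hi
  obtain ⟨n, rfl⟩ := Nat.exists_eq_add_of_le' (show 3 ≤ N by omega)
  exact ⟨n, hi.symm.trans hstart, hinj⟩

lemma cycleGraph_adj_iff {n : ℕ} {s t : Fin (n + 3)} :
    (SimpleGraph.cycleGraph (n + 3)).Adj s t ↔ t = s + 1 ∨ t = s - 1 := by
  rw [SimpleGraph.cycleGraph_adj, sub_eq_iff_eq_add', sub_eq_iff_eq_add',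
    eq_sub_iff_add_eq, or_comm, eq_comm (a := s)]

lemma fin_add_one_ne_sub_one {n : ℕ} (s : Fin (n + 3)) : s + 1 ≠ s - 1 := fun h => by
  rw [eq_sub_iff_add_eq, add_assoc, add_eq_left] at h
  simp [Fin.ext_iff, Fin.val_add, Nat.mod_eq_of_lt] at h

lemma nonempty_iso_cycleGraph (hconn : G.Connected) (h2 : ∀ v, deg G v = 2) :
    ∃ n, Nonempty (G ≃g SimpleGraph.cycleGraph (n + 3)) := by
  obtain ⟨v₀⟩ := hconn.nonempty
  obtain ⟨w₀, hw₀⟩ := deg_pos_iff.1 (show 0 < deg G v₀ by rw [h2]; norm_num)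
  obtain ⟨n, hstart, hinj⟩ := exists_track_eq_start h2 hw₀
  have hx : IsThread G (track G v₀ w₀) (n + 3) := isThread_track hw₀ fun m _ => h2 _
  let f : Fin (n + 3) → V := fun s => track G v₀ w₀ s
  have hf : Function.Injective f := fun s t he => Fin.ext (hinj s.2 t.2 he)
  have hsucc : ∀ s, G.Adj (f s) (f (s + 1)) := by
    intro s
    have hs := hx.1 s s.2
    simp only [f, Fin.val_add_one]
    split_ifs with hlast
    · rwa [show (s : ℕ) + 1 = n + 3 by simp [hlast], hstart] at hs
    · exact hs
  have hpred : ∀ s, G.Adj (f s) (f (s - 1)) := fun s => by simpa using (hsucc (s - 1)).symm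
  refine ⟨n, nonempty_iso_of_closed hconn f hf (fun s t hst => ?_) fun s w hw => ?_⟩
  · rcases cycleGraph_adj_iff.1 hst with rfl | rfl
    exacts [hsucc s, hpred s]
  · rcases eq_or_eq_of_deg_le_two (h2 _).le (hsucc s) (hpred s)
      (hf.ne (fin_add_one_ne_sub_one s)) hw with rfl | rfl
    · exact ⟨s + 1, cycleGraph_adj_iff.2 (.inl rfl), rfl⟩
    · exact ⟨s - 1, cycleGraph_adj_iff.2 (.inr rfl), rfl⟩

lemma three_dvd_of_dynThreeColorable {n : ℕ} (h2 : ∀ v, deg G v = 2)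
    (e : G ≃g SimpleGraph.cycleGraph (n + 3)) (h : DynThreeColorable G) : 3 ∣ n + 3 := by
  obtain ⟨c, hc, hdyn⟩ := h.exists_coloring
  have hsucc : ∀ m, Fin.ofNat (n + 3) (m + 1) = Fin.ofNat (n + 3) m + 1 := fun m => by
    simp [Fin.ext_iff, Fin.val_add]
  have hx : IsThread G (fun m => e.symm (Fin.ofNat (n + 3) m)) (n + 3) := by
    refine ⟨fun m _ => ?_, fun m _ => ⟨h2 _, e.symm.injective.ne ?_⟩⟩
    · rw [e.symm.map_adj_iff, cycleGraph_adj_iff, hsucc]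
      exact .inl rfl
    · rw [hsucc, hsucc, ne_comm, Ne, ← eq_sub_iff_add_eq]
      exact fin_add_one_ne_sub_one _
  by_contra h3
  exact hx.color_ne_color_of_mod_three_ne_zero hc hdyn (by omega)
    (by simp only [Fin.ofNat, Nat.mod_self, Nat.zero_mod])

lemma dynThreeColorable_of_three_dvd {n : ℕ} (e : G ≃g SimpleGraph.cycleGraph (n + 3))
    (h3 : 3 ∣ n + 3) : DynThreeColorable G := by
  have : Nonempty V := ⟨e.symm 0⟩
  let φ : Fin (n + 3) → Fin 3 := fun s => Fin.ofNat 3 s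
  have hsucc : ∀ s, φ (s + 1) = φ s + 1 := fun s => by
    simp only [φ, Fin.ext_iff, Fin.val_ofNat, Fin.val_add, Fin.val_one',
      Nat.mod_mod_of_dvd _ h3]
    simp
  have hpred : ∀ s, φ s = φ (s - 1) + 1 := fun s => by rw [← hsucc, sub_add_cancel]
  refine dynThreeColorable_of_coloring (fun v => φ (e v)) (fun u v huv he => ?_) fun v _ =>
    ⟨e.symm (e v + 1), e.symm (e v - 1), ?_, ?_, ?_⟩
  · rcases cycleGraph_adj_iff.1 (e.map_adj_iff.2 huv) with h | h
    · simp [h, hsucc] at he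
    · have := hpred (e u)
      simp [← h, he] at this
  · rw [← e.map_adj_iff, e.apply_symm_apply, cycleGraph_adj_iff]
    exact .inl rfl
  · rw [← e.map_adj_iff, e.apply_symm_apply, cycleGraph_adj_iff]
    exact .inr rfl
  · simp only [e.apply_symm_apply, hsucc, hpred (e v)]
    generalize φ (e v - 1) = a
    decide +revert

theorem dynThreeColorable_iff_three_dvd_card (hconn : G.Connected) (h2 : ∀ v, deg G v = 2) :
    DynThreeColorable G ↔ 3 ∣ Nat.card V := by
  obtain ⟨n, ⟨e⟩⟩ := nonempty_iso_cycleGraph hconn h2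
  rw [Nat.card_congr e.toEquiv, Nat.card_fin]
  exact ⟨three_dvd_of_dynThreeColorable h2 e, dynThreeColorable_of_three_dvd e⟩

end Cycles

/-! ### Reasoning about programs -/

section Programs

/-- Started in memory `s`, the program `P` halts after at most `T` steps in a memory
that satisfies `Q`. -/
def Halts (P : Prog) (s : Mem) (T : ℕ) (Q : Mem → Prop) : Prop :=
  ∃ t s', Runs P s t s' ∧ t ≤ T ∧ Q s'

/-- The program `P` contains no `store` and assigns only to registers in `W`. -/
def Prog.WritesOnly (W : Finset ℕ) : Prog → Prop
  | .const x _ | .copy x _ | .succ x _ | .pred x _ | .load x _ _ => x ∈ W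
  | .store _ _ _ => False
  | .seq P Q | .ite _ P Q => P.WritesOnly W ∧ Q.WritesOnly W
  | .loop _ P => P.WritesOnly W

instance Prog.decidableWritesOnly (W : Finset ℕ) : DecidablePred (Prog.WritesOnly W)
  | .const x _ | .copy x _ | .succ x _ | .pred x _ | .load x _ _ =>
    inferInstanceAs (Decidable (x ∈ W))
  | .store _ _ _ => inferInstanceAs (Decidable False)
  | .seq P Q | .ite _ P Q =>
    have := Prog.decidableWritesOnly W P
    have := Prog.decidableWritesOnly W Q
    inferInstanceAs (Decidable (P.WritesOnly W ∧ Q.WritesOnly W))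
  | .loop _ P => Prog.decidableWritesOnly W P

/-- The memories `s` and `s'` differ at most in the registers in `W`. -/
structure AgreeOff (W : Finset ℕ) (s s' : Mem) : Prop where
  arr_eq : s'.arr = s.arr
  reg_eq : ∀ r ∉ W, s'.reg r = s.reg r

infixr:60 ";;" => Prog.seq

variable {P P' : Prog} {s s' s'' : Mem} {t T T' : ℕ} {Q R : Mem → Prop} {W W' : Finset ℕ}

@[simp] lemma reg_setReg (s : Mem) (x k y : ℕ) :
    (s.setReg x k).reg y = if y = x then k else s.reg y := by
  simp [Mem.setReg, Function.update_apply]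

@[simp] lemma arr_setReg (s : Mem) (x k : ℕ) : (s.setReg x k).arr = s.arr := rfl

@[simp] lemma holds_eq (s : Mem) (x y : ℕ) : (Test.eq x y).Holds s ↔ s.reg x = s.reg y := Iff.rfl

@[simp] lemma holds_lt (s : Mem) (x y : ℕ) : (Test.lt x y).Holds s ↔ s.reg x < s.reg y := Iff.rfl

lemma AgreeOff.refl (W : Finset ℕ) (s : Mem) : AgreeOff W s s := ⟨rfl, fun _ _ => rfl⟩

lemma AgreeOff.trans (h : AgreeOff W s s') (h' : AgreeOff W s' s'') : AgreeOff W s s'' :=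
  ⟨h'.arr_eq.trans h.arr_eq, fun r hr => (h'.reg_eq r hr).trans (h.reg_eq r hr)⟩

lemma AgreeOff.mono (h : AgreeOff W s s') (hW : W ⊆ W') : AgreeOff W' s s' :=
  ⟨h.arr_eq, fun r hr => h.reg_eq r fun hr' => hr (hW hr')⟩

lemma AgreeOff.setReg (h : AgreeOff W s s') {x : ℕ} (hx : x ∈ W) (k : ℕ) :
    AgreeOff W s (s'.setReg x k) :=
  ⟨h.arr_eq, fun r hr => by
    rw [reg_setReg, if_neg (ne_of_mem_of_not_mem hx hr).symm, h.reg_eq r hr]⟩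

lemma Runs.agreeOff (h : Runs P s t s') (hP : P.WritesOnly W) : AgreeOff W s s' := by
  induction h with
  | const | copy | succ | pred | load => exact (AgreeOff.refl W _).setReg hP _
  | store => exact hP.elim
  | seq _ _ ih ih' => exact (ih hP.1).trans (ih' hP.2)
  | ite_true _ _ ih => exact ih hP.1
  | ite_false _ _ ih => exact ih hP.2
  | loop_false => exact .refl W _
  | loop_true _ _ _ ih ih' => exact (ih hP).trans (ih' hP)

lemma Prog.WritesOnly.mono (h : P.WritesOnly W) (hW : W ⊆ W') : P.WritesOnly W' := by
  induction P with
  | const | copy | succ | pred | load => exact hW h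
  | store => exact h
  | seq _ _ ih ih' | ite _ _ _ ih ih' => exact ⟨ih h.1, ih' h.2⟩
  | loop _ _ ih => exact ih h

lemma Halts.of_le (hT : T ≤ T') (h : Halts P s T Q) : Halts P s T' Q := by
  obtain ⟨t, s', hr, ht, hq⟩ := h
  exact ⟨t, s', hr, ht.trans hT, hq⟩

lemma Halts.mono (h : Halts P s T Q) (hQ : ∀ s', Q s' → R s') : Halts P s T R := by
  obtain ⟨t, s', hr, ht, hq⟩ := h
  exact ⟨t, s', hr, ht, hQ s' hq⟩

lemma Halts.frame (h : Halts P s T Q) (hP : P.WritesOnly W) :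
    Halts P s T fun s' => AgreeOff W s s' ∧ Q s' := by
  obtain ⟨t, s', hr, ht, hq⟩ := h
  exact ⟨t, s', hr, ht, hr.agreeOff hP, hq⟩

lemma Halts.seq (h : Halts P s T fun s' => Halts P' s' T' Q) : Halts (P ;; P') s (T + T') Q := by
  obtain ⟨t, s', hr, ht, t', s'', hr', ht', hq⟩ := h
  exact ⟨_, s'', hr.seq hr', by omega, hq⟩

lemma Halts.seq_of_frame (h : Halts P s T R) (hP : P.WritesOnly W)
    (h' : ∀ s', AgreeOff W s s' → R s' → Halts P' s' T' Q) : Halts (P ;; P') s (T + T') Q :=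
  .seq ((h.frame hP).mono fun s' hs' => h' s' hs'.1 hs'.2)

lemma Halts.const {x k : ℕ} (h : Q (s.setReg x k)) : Halts (.const x k) s 1 Q :=
  ⟨1, _, .const s x k, le_rfl, h⟩

lemma Halts.copy {x y : ℕ} (h : Q (s.setReg x (s.reg y))) : Halts (.copy x y) s 1 Q :=
  ⟨1, _, .copy s x y, le_rfl, h⟩

lemma Halts.succ {x y : ℕ} (h : Q (s.setReg x (s.reg y + 1))) : Halts (.succ x y) s 1 Q :=
  ⟨1, _, .succ s x y, le_rfl, h⟩

lemma Halts.pred {x y : ℕ} (h : Q (s.setReg x (s.reg y - 1))) : Halts (.pred x y) s 1 Q :=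
  ⟨1, _, .pred s x y, le_rfl, h⟩

lemma Halts.load {x a y : ℕ} (h : Q (s.setReg x (s.arr a (s.reg y)))) :
    Halts (.load x a y) s 1 Q :=
  ⟨1, _, .load s x a y, le_rfl, h⟩

lemma Halts.ite {b : Test} (h : b.Holds s → Halts P s T Q) (h' : ¬ b.Holds s → Halts P' s T' Q) :
    Halts (.ite b P P') s (max T T' + 1) Q := by
  by_cases hb : b.Holds s
  · obtain ⟨t, s', hr, ht, hq⟩ := h hb
    exact ⟨_, s', .ite_true hb hr, by omega, hq⟩
  · obtain ⟨t, s', hr, ht, hq⟩ := h' hb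
    exact ⟨_, s', .ite_false hb hr, by omega, hq⟩

lemma Halts.loop {b : Test} {k : ℕ} {I : ℕ → Mem → Prop} {B : Fin k → ℕ}
    (hstep : ∀ (m : Fin k) (s : Mem), I m s → b.Holds s ∧ Halts P s (B m) (I (m + 1)))
    (hend : ∀ s, I k s → ¬ b.Holds s) (h0 : I 0 s) :
    Halts (.loop b P) s (∑ m, (B m + 1) + 1) (I k) := by
  induction k generalizing s I with
  | zero => exact ⟨1, s, .loop_false (hend s h0), by simp, h0⟩
  | succ k ih =>
    obtain ⟨hb, t, s', hr, ht, h1⟩ := hstep 0 s h0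
    obtain ⟨t', s'', hr', ht', hq⟩ := ih (I := fun m => I (m + 1)) (B := fun m => B m.succ)
      (fun m s hs => hstep m.succ s (by simpa using hs)) hend h1
    refine ⟨_, s'', .loop_true hb hr hr', ?_, hq⟩
    rw [Fin.sum_univ_succ]
    omega

/-- The program that does nothing. Register `1` is a scratch register throughout. -/
def skip : Prog := .copy 1 1

lemma Halts.skip (h : Q s) : Halts skip s 1 Q :=
  .copy (by rwa [Mem.setReg, Function.update_eq_self])

/-- If register `x` holds the number `k` then `P` else `P'`. -/
def ifEq (x k : ℕ) (P P' : Prog) : Prog := .const 1 k ;; .ite (.eq x 1) P P'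

lemma Halts.ifEq {x k : ℕ} (hx : x ≠ 1) (h : s.reg x = k → Halts P (s.setReg 1 k) T Q)
    (h' : s.reg x ≠ k → Halts P' (s.setReg 1 k) T' Q) :
    Halts (ifEq x k P P') s (max T T' + 2) Q :=
  .of_le (by omega) <| .seq <| .const <|
    .ite (fun hb => h (by simpa [hx] using hb)) fun hb => h' (by simpa [hx] using hb)

end Programs

/-! ### The input -/

section Input

variable {n : ℕ} {G : SimpleGraph (Fin n)} {adj : Fin n → List (Fin n)} {s s' : Mem}

/-- The position at which the adjacency list of `i` starts. -/
def start (adj : Fin n → List (Fin n)) (i : ℕ) : ℕ := ((List.ofFn adj).take i).flatten.length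

/-- The memory contains the input graph. -/
structure HasInput (adj : Fin n → List (Fin n)) (s : Mem) : Prop where
  arr_eq : s.arr = (initialMem adj).arr
  reg_zero : s.reg 0 = n

lemma HasInput.of_agreeOff {W : Finset ℕ} (h : HasInput adj s) (h' : AgreeOff W s s')
    (hW : 0 ∉ W) : HasInput adj s' :=
  ⟨h'.arr_eq.trans h.arr_eq, (h'.reg_eq 0 hW).trans h.reg_zero⟩

lemma HasInput.setReg (h : HasInput adj s) {x : ℕ} (hx : 0 ≠ x) (k : ℕ) :
    HasInput adj (s.setReg x k) :=
  ⟨h.arr_eq, by rw [reg_setReg, if_neg hx, h.reg_zero]⟩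

lemma start_succ (v : Fin n) : start adj (v + 1) = start adj v + (adj v).length := by
  rw [start, start, List.take_add_one]
  simp

lemma getElem?_flatten {α : Type*} (l : List (List α)) {i k : ℕ} (hi : i < l.length)
    (hk : k < l[i].length) : l.flatten[(l.take i).flatten.length + k]? = some l[i][k] := by
  induction l generalizing i with
  | nil => simp at hi
  | cons a l ih =>
    rcases i with _ | i
    · simp only [List.getElem_cons_zero] at hk
      simp [List.getElem?_append_left, hk]
    · rw [List.flatten_cons, List.take_succ_cons, List.flatten_cons, List.length_append,
        List.getElem?_append_right (by omega), add_assoc, Nat.add_sub_cancel_left]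
      exact ih (by simpa using hi) (by simpa using hk)

lemma HasInput.arr_zero (h : HasInput adj s) {i : ℕ} (hi : i ≤ n) : s.arr 0 i = start adj i := by
  rw [h.arr_eq]
  simp [initialMem, hi, start]

lemma HasInput.arr_one (h : HasInput adj s) (v : Fin n) {k : ℕ} (hk : k < (adj v).length) :
    s.arr 1 (start adj v + k) = ((adj v)[k]).val := by
  have hget := getElem?_flatten (List.ofFn adj) (i := v) (k := k) (by simp) (by simpa using hk)
  have harr (i : ℕ) : s.arr 1 i = ((List.ofFn adj).flatten.map Fin.val).getD i 0 := by
    rw [h.arr_eq]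
    rfl
  rw [harr, List.getD_eq_getElem?_getD, List.getElem?_map, start, hget]
  simp

end Input

/-! ### Loops over neighbors and vertices -/

section Loops

variable {n : ℕ} {G : SimpleGraph (Fin n)} {adj : Fin n → List (Fin n)} {s : Mem} {v : Fin n}
  {P : Prog} {W : Finset ℕ} {x k f : ℕ}

lemma deg_eq_length (hadj : IsAdjLists G adj) (v : Fin n) : deg G v = (adj v).length := by
  classical
  have hset : G.neighborSet v = ((adj v).toFinset : Set (Fin n)) := by
    ext u
    simp [(hadj v).2 u]
  rw [deg, hset, Set.ncard_coe_finset, List.toFinset_card_of_nodup (hadj v).1]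

/-- Let the registers `k` and `k + 1` hold the start and the end of the adjacency list of the vertex
in register `x`. -/
def loadRange (x k : ℕ) : Prog := .load k 0 x ;; .succ (k + 1) x ;; .load (k + 1) 0 (k + 1)

lemma halts_loadRange (h : HasInput adj s) (hv : s.reg x = v) (hx : x ≠ k) :
    Halts (loadRange x k) s 3 fun s' =>
      s'.reg k = start adj v ∧ s'.reg (k + 1) = start adj v + (adj v).length := by
  have hstart := h.arr_zero v.2.le
  have hend := h.arr_zero (i := v + 1) (by omega)
  rw [start_succ] at hend
  exact .seq (.load (.seq (.succ (.load (by simp [hv, hx, hstart, hend])))))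

/-- Execute `P` for every neighbor of the vertex in register `x`. Register `k + 2` holds the
neighbor, and the registers `k` and `k + 1` delimit the rest of the adjacency list. -/
def forNbrs (x k : ℕ) (P : Prog) : Prog :=
  loadRange x k ;; .loop (.lt k (k + 1)) (.load (k + 2) 1 k ;; P ;; .succ k k)

lemma halts_forNbrs {g B : Fin n → ℕ} (h : HasInput adj s) (hv : s.reg x = v)
    (hP : P.WritesOnly W) (hx : x ≠ k) (hk : k ≠ 0) (hW : 0 ∉ W ∧ k ∉ W ∧ k + 1 ∉ W)
    (hf : f ∉ ({k, k + 1, k + 2} : Finset ℕ))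
    (hbody : ∀ w ∈ adj v, ∀ s', AgreeOff (W ∪ {k, k + 1, k + 2}) s s' → s'.reg (k + 2) = w →
      Halts P s' (B w) fun s'' => s''.reg f = s'.reg f + g w) :
    Halts (forNbrs x k P) s (((adj v).map fun w => B w + 3).sum + 4) fun s' =>
      s'.reg f = s.reg f + ((adj v).map g).sum := by
  simp only [Finset.mem_insert, Finset.mem_singleton, not_or] at hf
  let I (m : ℕ) (s' : Mem) : Prop := AgreeOff (W ∪ {k, k + 1, k + 2}) s s' ∧
    s'.reg k = start adj v + m ∧ s'.reg (k + 1) = start adj v + (adj v).length ∧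
    s'.reg f = s.reg f + (((adj v).take m).map g).sum
  have hstep (m : Fin (adj v).length) (s' : Mem) (hI : I m s') :
      (Test.lt k (k + 1)).Holds s' ∧
        Halts (.load (k + 2) 1 k ;; P ;; .succ k k) s' (B (adj v)[m] + 2) (I (m + 1)) := by
    obtain ⟨hs, hpos, hend, hsum⟩ := hI
    have hin := h.of_agreeOff hs (by simp [hW.1]; omega)
    have hw := hin.arr_one v m.2
    have hs₁ := hs.setReg (x := k + 2) (by simp) (s'.arr 1 (s'.reg k))
    refine ⟨by simp [hpos, hend], .of_le (by omega) <| .seq <| .load <|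
      .seq_of_frame (hbody (adj v)[m] (by simp) _ hs₁ (by simp [hpos, hw])) hP fun s₂ hs₂ hf₂ =>
        .succ ⟨(hs₁.trans (hs₂.mono Finset.subset_union_left)).setReg (by simp) _, ?_, ?_, ?_⟩⟩
    · simp [hs₂.reg_eq k hW.2.1, hpos, add_assoc]
    · simp [hs₂.reg_eq (k + 1) hW.2.2, hend]
    · rw [List.take_add_one, List.map_append, List.sum_append]
      simp [hf, hf₂, hsum, add_assoc]
  have hdone (s' : Mem) : I (adj v).length s' → ¬ (Test.lt k (k + 1)).Holds s' :=
    fun ⟨_, hpos, hend, _⟩ => by simp [hpos, hend]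
  have hloop (s₁ : Mem) := Halts.loop (s := s₁) (B := fun m => B (adj v)[m] + 2) hstep hdone
  refine .of_le ?_ <| .seq_of_frame (W := {k, k + 1}) (halts_loadRange h hv hx)
    (by simp [loadRange, Prog.WritesOnly]) fun s₁ hs₁ ⟨hstart, hend⟩ =>
      (hloop s₁ ?_).mono fun s' hs' => ?_
  · simp only [Fin.getElem_fin, add_assoc, Nat.reduceAdd,
      Fin.sum_univ_fun_getElem (adj v) fun w => B w + 3]
    omega
  · exact ⟨hs₁.mono (by grind), hstart, hend, by simp [hs₁.reg_eq f (by simp [hf])]⟩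
  · simpa using hs'.2.2.2

lemma halts_forNbrs_of_length_le {g : Fin n → ℕ} {b d : ℕ} (h : HasInput adj s)
    (hv : s.reg x = v) (hP : P.WritesOnly W) (hx : x ≠ k) (hk : k ≠ 0)
    (hW : 0 ∉ W ∧ k ∉ W ∧ k + 1 ∉ W) (hf : f ∉ ({k, k + 1, k + 2} : Finset ℕ))
    (hd : (adj v).length ≤ d)
    (hbody : ∀ w ∈ adj v, ∀ s', AgreeOff (W ∪ {k, k + 1, k + 2}) s s' → s'.reg (k + 2) = w →
      Halts P s' b fun s'' => s''.reg f = s'.reg f + g w) :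
    Halts (forNbrs x k P) s (d * (b + 3) + 4) fun s' =>
      s'.reg f = s.reg f + ((adj v).map g).sum := by
  refine (halts_forNbrs h hv hP hx hk hW hf hbody).of_le ?_
  simpa using Nat.mul_le_mul_right (b + 3) hd

/-- Execute `P` for every vertex, held by register `3`, where register `4` is a counter that starts
with `0`. -/
def countVertices (P : Prog) : Prog :=
  .const 4 0 ;; .const 3 0 ;; .loop (.lt 3 0) (P ;; .succ 3 3)

lemma halts_countVertices {g B : Fin n → ℕ} (h : HasInput adj s) (hP : P.WritesOnly W)
    (hW : 0 ∉ W ∧ 3 ∉ W)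
    (hbody : ∀ (v : Fin n) (s : Mem), HasInput adj s → s.reg 3 = v →
      Halts P s (B v) fun s' => s'.reg 4 = s.reg 4 + g v) :
    Halts (countVertices P) s (∑ v, (B v + 2) + 3) fun s' => s'.reg 4 = ∑ v, g v := by
  let I (m : ℕ) (s' : Mem) : Prop :=
    HasInput adj s' ∧ s'.reg 3 = m ∧ s'.reg 4 = ∑ v with v.val < m, g v
  have hstep (v : Fin n) (s' : Mem) (hI : I v s') : (Test.lt 3 0).Holds s' ∧
      Halts (P ;; .succ 3 3) s' (B v + 1) (I (v + 1)) := by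
    obtain ⟨hin, hv, hsum⟩ := hI
    refine ⟨by simp [hv, hin.reg_zero], .seq_of_frame (hbody v s' hin hv) hP fun s₁ hs₁ h4 =>
      .succ ⟨(hin.of_agreeOff hs₁ hW.1).setReg (by simp) _, ?_, ?_⟩⟩
    · simp [hs₁.reg_eq 3 hW.2, hv]
    · have hinsert : ({u | u.val < v + 1} : Finset (Fin n)) =
          insert v ({u | u.val < v} : Finset (Fin n)) := by
        ext u
        simp [Fin.ext_iff, le_iff_eq_or_lt]
      rw [hinsert, Finset.sum_insert (by simp)]
      simp [h4, hsum, add_comm]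
  have hdone (s' : Mem) : I n s' → ¬ (Test.lt 3 0).Holds s' :=
    fun ⟨hin, hv, _⟩ => by simp [hv, hin.reg_zero]
  refine .of_le ?_ <| .seq <| .const <| .seq <| .const <|
    (Halts.loop hstep hdone ?_).mono fun s' hs' => ?_
  · simp only [add_assoc, Nat.reduceAdd]
    omega
  · exact ⟨(h.setReg (by simp) _).setReg (by simp) _, by simp, by simp⟩
  · simpa using hs'.2.2

lemma halts_countVertices_of_forall {p : Fin n → Prop} [DecidablePred p] {b : ℕ}
    (h : HasInput adj s) (hP : P.WritesOnly W) (hW : 0 ∉ W ∧ 3 ∉ W)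
    (hbody : ∀ (v : Fin n) (s : Mem), HasInput adj s → s.reg 3 = v →
      Halts P s b fun s' => s'.reg 4 = s.reg 4 + if p v then 1 else 0) :
    Halts (countVertices P) s ((b + 2) * n + 3) fun s' => s'.reg 4 = {v | p v}.ncard :=
  ((halts_countVertices h hP hW hbody).of_le (by simp [mul_comm])).mono fun s' hs' => by
    rw [hs', ← Finset.card_filter, Set.ncard_eq_toFinset_card', Set.toFinset_ofPred]

end Loops

/-! ### The determination procedure -/

section Determination

variable {n : ℕ} {G : SimpleGraph (Fin n)} {adj : Fin n → List (Fin n)} {s : Mem} {v : Fin n}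
  {P : Prog} {W : Finset ℕ} {x : ℕ} {p : Prop}

/-- Started in memory `s`, the program `P` halts after at most `T` steps, and register `0` then
holds the truth value of `p`. -/
def Decides (P : Prog) (s : Mem) (T : ℕ) (p : Prop) : Prop :=
  Halts P s T fun s' => (p → s'.reg 0 = 1) ∧ (¬ p → s'.reg 0 = 0)

lemma decides_true (hp : p) : Decides (.const 0 1) s 1 p := .const (by simp [hp])

lemma decides_false (hp : ¬ p) : Decides (.const 0 0) s 1 p := .const (by simp [hp])

lemma decides_ifEq {k T₀ T T' : ℕ} {q : Prop} {P₀ P P' : Prog} (h : HasInput adj s)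
    (hP₀ : P₀.WritesOnly W) (hW : 0 ∉ W) (hcount : Halts P₀ s T₀ fun s' => s'.reg 4 = k ↔ q)
    (hP : q → ∀ s', HasInput adj s' → Decides P s' T p)
    (hP' : ¬ q → ∀ s', HasInput adj s' → Decides P' s' T' p) :
    Decides (P₀ ;; ifEq 4 k P P') s (T₀ + (max T T' + 2)) p :=
  .seq_of_frame hcount hP₀ fun s₁ hs₁ hq =>
    have hin := (h.of_agreeOff hs₁ hW).setReg (x := 1) (by decide) k
    .ifEq (by decide) (fun h4 => hP (hq.1 h4) _ hin) fun h4 => hP' (mt hq.2 h4) _ hin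

/-- Let register `2` hold the degree of the vertex in register `x`. -/
def loadDeg (x : ℕ) : Prog := .const 2 0 ;; forNbrs x 10 (.succ 2 2)

lemma halts_loadDeg (hadj : IsAdjLists G adj) (h : HasInput adj s) (hv : s.reg x = v)
    (hd : deg G v ≤ 3) (hx : x ≠ 2 ∧ x ≠ 10) :
    Halts (loadDeg x) s 17 fun s' => s'.reg 2 = deg G v := by
  rw [deg_eq_length hadj] at hd ⊢
  refine .seq (T := 1) (.const <| (halts_forNbrs_of_length_le (W := {2}) (f := 2) (g := fun _ => 1)
    (b := 1) (h.setReg (by decide) 0) (by simp [hx.1, hv]) (by decide) hx.2 (by decide) (by decide)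
    (by decide) hd ?_).mono fun s' hs' => ?_)
  · exact fun w _ s' _ _ => .succ (by simp)
  · simpa using hs'

/-- Let register `4` hold the number of vertices of degree `d`. -/
def countDegree (d : ℕ) : Prog := countVertices (loadDeg 3 ;; ifEq 2 d (.succ 4 4) skip)

lemma halts_countDegree (hadj : IsAdjLists G adj) (hmax : ∀ v, deg G v ≤ 3) (h : HasInput adj s)
    (d : ℕ) : Halts (countDegree d) s (22 * n + 3) fun s' =>
      s'.reg 4 = {v | deg G v = d}.ncard := by
  refine halts_countVertices_of_forall (W := {1, 2, 4, 10, 11, 12}) (b := 20) h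
    (by simp [loadDeg, forNbrs, loadRange, ifEq, skip, Prog.WritesOnly]) (by decide) ?_
  intro v s hin hv
  refine .seq_of_frame (W := {2, 10, 11, 12}) (halts_loadDeg hadj hin hv (hmax v) (by decide))
    (by decide) fun s₁ hs₁ hdeg => .ifEq (T := 1) (T' := 1) (by decide)
      (fun hd => .succ ?_) fun hd => .skip ?_
  · simp [hs₁.reg_eq 4 (by decide), ← hdeg, hd]
  · simp [hs₁.reg_eq 4 (by decide), ← hdeg, hd]

/-- Let register `4` hold the number of vertices of degree `3`, held by register `3`, for which `P`
leaves register `5` at `0`. -/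
def countCubic (P : Prog) : Prog :=
  countVertices
    (loadDeg 3 ;; ifEq 2 3 (.const 5 0 ;; P ;; ifEq 5 0 (.succ 4 4) skip) skip)

lemma halts_countCubic {g : Fin n → ℕ} {b : ℕ} (hadj : IsAdjLists G adj)
    (hmax : ∀ v, deg G v ≤ 3) (h : HasInput adj s)
    (hP : P.WritesOnly (insert 1 (insert 2 (Finset.Icc 5 21))))
    (hbody : ∀ (v : Fin n) (s : Mem), HasInput adj s → s.reg 3 = v →
      Halts P s b fun s' => s'.reg 5 = s.reg 5 + g v) :
    Halts (countCubic P) s ((b + 25) * n + 3) fun s' =>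
      s'.reg 4 = {v | deg G v = 3 ∧ g v = 0}.ncard := by
  refine halts_countVertices_of_forall (W := insert 1 (insert 2 (Finset.Icc 4 21))) (b := b + 23) h
    ?_ (by decide) fun v s hin hv => ?_
  · simp only [ifEq, Prog.WritesOnly, hP.mono (W' := insert 1 (insert 2 (Finset.Icc 4 21)))
      (by decide)]
    decide
  refine .of_le ?_ <| .seq_of_frame (W := {2, 10, 11, 12})
    (halts_loadDeg hadj hin hv (hmax v) (by decide)) (by decide) fun s₁ hs₁ hdeg =>
    .ifEq (x := 2) (T := 1 + (b + 3)) (T' := 1) (by decide) (fun hd => .seq <| .const ?_)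
      fun hd => .skip ?_
  · omega
  · have hin₁ := hin.of_agreeOff hs₁ (by decide)
    refine .seq_of_frame (hbody v _ ((hin₁.setReg (x := 1) (by decide) 3).setReg
      (x := 5) (by decide) 0) (by simp [hs₁.reg_eq 3 (by decide), hv])) hP fun s₂ hs₂ h5 => ?_
    have hg : s₂.reg 5 = g v := by simpa using h5
    refine .ifEq (T := 1) (T' := 1) (by decide) (fun h0 => .succ ?_) fun h0 => .skip ?_
    · simp [hs₂.reg_eq 4 (by decide), hs₁.reg_eq 4 (by decide), ← hdeg, hd, ← hg, h0]
    · simp [hs₂.reg_eq 4 (by decide), hs₁.reg_eq 4 (by decide), ← hdeg, hd, ← hg, h0]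
  · simp [hs₁.reg_eq 4 (by decide), ← hdeg, hd]

/-- Add to register `5` the number of neighbors of degree other than `3` of the vertex in
register `3`. -/
def countNonCubicNbrs : Prog := forNbrs 3 13 (loadDeg 15 ;; ifEq 2 3 skip (.succ 5 5))

lemma halts_countNonCubicNbrs (hadj : IsAdjLists G adj) (hmax : ∀ v, deg G v ≤ 3)
    (h : HasInput adj s) (hv : s.reg 3 = v) :
    Halts countNonCubicNbrs s 73 fun s' => s'.reg 5 =
      s.reg 5 + ((adj v).map fun w => if deg G w = 3 then 0 else 1).sum := by
  refine halts_forNbrs_of_length_le (W := {1, 2, 5, 10, 11, 12}) (k := 13) (f := 5)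
    (P := loadDeg 15 ;; ifEq 2 3 skip (.succ 5 5)) (b := 20) h hv (by decide)
    (by decide) (by decide) (by decide) (by decide) (deg_eq_length hadj v ▸ hmax v) ?_
  intro w _ s' hs' hw
  refine .seq_of_frame (W := {2, 10, 11, 12})
    (halts_loadDeg hadj (h.of_agreeOff hs' (by decide)) hw (hmax w) (by decide)) (by decide)
    fun s₁ hs₁ hdeg => .ifEq (T := 1) (T' := 1) (by decide) (fun hd => .skip ?_)
      fun hd => .succ ?_
  · simp [hs₁.reg_eq 5 (by decide), ← hdeg, hd]
  · simp [hs₁.reg_eq 5 (by decide), ← hdeg, hd]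

lemma halts_countFull (hadj : IsAdjLists G adj) (hmax : ∀ v, deg G v ≤ 3)
    (h : HasInput adj s) : Halts (countCubic countNonCubicNbrs) s (98 * n + 3) fun s' =>
      s'.reg 4 = {v | IsFull G v}.ncard := by
  refine (halts_countCubic hadj hmax h (by decide) fun v s hin hv =>
    halts_countNonCubicNbrs hadj hmax hin hv).mono fun s' hs' => ?_
  rw [hs']
  congr 2 with v
  simp [IsFull, List.sum_eq_zero_iff_forall_eq_nat, (hadj v).2]

/-- Carry out the determination procedure. Membership in `ℰ` is tested by counting the vertices of
degree `3` all of whose neighbors have degree `3`. -/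
def determine : Prog :=
  countDegree 1 ;; ifEq 4 0
    (countDegree 3 ;; ifEq 4 4
      ((countCubic countNonCubicNbrs ;; .pred 4 4) ;; ifEq 4 0 (.const 0 1) (.const 0 0))
      (.const 0 1))
    (.const 0 1)

lemma decides_determine (hadj : IsAdjLists G adj) (hconn : G.Connected) (hG : InC G)
    (h : HasInput adj s) : Decides determine s (142 * n + 17) (DeterminationAnswer G) := by
  have hmax := hG.1
  have hleaf : {v | deg G v = 1}.ncard = 0 ↔ ¬ ∃ v, deg G v = 1 := by
    rw [Set.ncard_eq_zero, Set.eq_empty_iff_forall_notMem, not_exists]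
    rfl
  rw [determinationAnswer_iff hconn hG]
  refine .of_le ?_ <| decides_ifEq (T := 22 * n + 3 + (98 * n + 7 + 2)) (T' := 1) h
    (W := insert 1 (insert 2 (Finset.Icc 3 21))) (by decide) (by decide)
    ((halts_countDegree hadj hmax h 1).mono fun _ hc => by rw [hc, hleaf])
    (fun hq₁ s₁ h₁ => ?_) fun hq₁ _ _ => decides_true (.inl (not_not.1 hq₁))
  · omega
  refine .of_le ?_ <| decides_ifEq (T := 98 * n + 3 + 1 + 3) (T' := 1) h₁
    (W := insert 1 (insert 2 (Finset.Icc 3 21))) (by decide) (by decide)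
    ((halts_countDegree hadj hmax h₁ 3).mono fun _ hc => by rw [hc]) (fun hq₃ s₂ h₂ => ?_)
    fun hq₃ _ _ => decides_true (.inr (.inl hq₃))
  · omega
  refine decides_ifEq (T := 1) (T' := 1) (q := {v | IsFull G v}.ncard ≤ 1) h₂
    (W := insert 1 (insert 2 (Finset.Icc 3 21))) (by decide) (by decide)
    (.seq ((halts_countFull hadj hmax h₂).mono fun s₃ hfull => .pred <| by
      rw [reg_setReg, if_pos rfl, hfull, Nat.sub_eq_zero_iff_le]))
    (fun hq _ _ => decides_true (.inr (.inr (by omega)))) fun hq _ _ => decides_false ?_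
  rintro (h₀ | h₀ | h₀)
  exacts [hq₁ h₀, h₀ hq₃, hq (by omega)]

theorem determine_decides : DecidesInLinearTime determine (fun _ G => G.Connected ∧ InC G)
    (fun _ G => DeterminationAnswer G) :=
  ⟨159, fun _ hn _ _ hadj ⟨hconn, hG⟩ =>
    (decides_determine hadj hconn hG ⟨rfl, rfl⟩).of_le (by omega)⟩

/-- Decide whether the number in register `0` is divisible by three. -/
def divisibleByThree : Prog :=
  .copy 2 0 ;; .const 3 2 ;; .loop (.lt 3 2) (.pred 2 2 ;; .pred 2 2 ;; .pred 2 2) ;;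
    ifEq 2 0 (.const 0 1) (.const 0 0)

lemma decides_divisibleByThree (h : s.reg 0 = n) :
    Decides divisibleByThree s (4 * n + 6) (3 ∣ n) := by
  let I (m : ℕ) (s' : Mem) : Prop := s'.reg 3 = 2 ∧ s'.reg 2 = n - 3 * m
  have hstep (m : Fin (n / 3)) (s' : Mem) (hI : I m s') : (Test.lt 3 2).Holds s' ∧
      Halts (.pred 2 2 ;; .pred 2 2 ;; .pred 2 2) s' 3 (I (m + 1)) := by
    obtain ⟨h3, h2⟩ := hI
    refine ⟨by rw [holds_lt, h3, h2]; omega, .seq <| .pred <| .seq <| .pred <| .pred ?_⟩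
    exact ⟨by simp [h3], by simp [h2]; omega⟩
  have hdone (s' : Mem) : I (n / 3) s' → ¬ (Test.lt 3 2).Holds s' := fun ⟨h3, h2⟩ => by
    rw [holds_lt, h3, h2]
    omega
  refine .of_le ?_ <| .seq <| .copy <| .seq <| .const <|
    .seq <| (Halts.loop hstep hdone (by simp [I, h])).mono fun s' ⟨_, h2⟩ =>
      .ifEq (T := 1) (T' := 1) (by decide) (fun h0 => decides_true (by rw [h2] at h0; omega))
        fun h0 => decides_false (by rw [h2] at h0; omega)
  simp only [Finset.sum_const, Finset.card_univ, Fintype.card_fin, smul_eq_mul]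
  omega

/-- Decide dynamic 3-colorability. The graph is a cycle if all `n` vertices have degree `2`. -/
def decideColorable : Prog := countDegree 2 ;; .ite (.eq 4 0) divisibleByThree determine

lemma decides_decideColorable (hadj : IsAdjLists G adj) (hconn : G.Connected) (hG : InC G)
    (h : HasInput adj s) : Decides decideColorable s (164 * n + 27) (DynThreeColorable G) := by
  have hcycle : {v | deg G v = 2}.ncard = n ↔ ∀ v, deg G v = 2 := by
    simpa [Set.eq_univ_iff_forall] using (Set.eq_univ_iff_ncard {v | deg G v = 2}).symm
  refine .of_le ?_ <| .seq_of_frame (halts_countDegree hadj hG.1 h 2)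
    (W := insert 1 (insert 2 (Finset.Icc 3 21))) (by decide) fun s' hs hc =>
      have hin := h.of_agreeOff hs (by decide)
      .ite (T := 4 * n + 6) (T' := 142 * n + 17) (fun hn => ?_) fun hn => ?_
  · omega
  · have h2 := hcycle.1 (by rw [← hc, hn, hin.reg_zero])
    rw [dynThreeColorable_iff_three_dvd_card hconn h2, Nat.card_fin]
    exact decides_divisibleByThree hin.reg_zero
  · have h2 : ¬ ∀ v, deg G v = 2 := fun h2 => hn (by rw [holds_eq, hc, hcycle.2 h2, hin.reg_zero])
    rw [dynThreeColorable_iff_determinationAnswer hconn hG h2]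
    exact decides_determine hadj hconn hG hin

theorem decideColorable_decides :
    DecidesInLinearTime decideColorable (fun _ G => G.Connected ∧ InC G)
      (fun _ G => DynThreeColorable G) :=
  ⟨191, fun _ hn _ _ hadj ⟨hconn, hG⟩ =>
    (decides_decideColorable hadj hconn hG ⟨rfl, rfl⟩).of_le (by omega)⟩

end Determination

/-! ### Bad threads -/

section BadThreads

variable {V : Type*} [Finite V] {G : SimpleGraph V}

/-- The thread that starts with `u`, `w` is an `A_i` with `i` of the form `3 j + 1`. -/
def BadThread (G : SimpleGraph V) (u w : V) : Prop :=
  deg G (tip G u w) = 3 ∧ threadLength G u w % 3 = 0 ∧ tip G u w ≠ u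

lemma inC_iff : InC G ↔ (∀ v, deg G v ≤ 3) ∧ ClawFree G ∧
    ∀ u w, deg G u = 3 → G.Adj u w → ¬ BadThread G u w := by
  refine and_congr_right fun _ => and_congr_right fun _ => ⟨?_, fun h j hj hA => ?_⟩
  · rintro hA u w hu huw ⟨hdeg, hmod, hne⟩
    obtain ⟨-, ht, -⟩ := threadLength_spec huw (by omega)
    exact ht.mod_three_ne_zero hA hu hdeg hne.symm hmod
  · obtain ⟨x, hx, h0, hk, hne⟩ := hA.exists_isThread (by omega)
    obtain ⟨hlen, htip⟩ := threadLength_eq (by omega) hx (by omega) (by omega) rfl rfl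
    exact h (x 0) (x 1) h0 (hx.1 0 (by omega))
      ⟨by rwa [htip], by omega, by rw [htip]; exact hne.symm⟩

lemma track_pair_injective {u w u' w' : V} (hu : deg G u ≠ 2) (hu' : deg G u' ≠ 2)
    (hw : G.Adj u w) (hw' : G.Adj u' w') {m m' : ℕ} (hm : m < threadLength G u w)
    (hm' : m' < threadLength G u' w') (h : track G u w m = track G u' w' m')
    (h' : track G u w (m + 1) = track G u' w' (m' + 1)) : u = u' ∧ w = w' ∧ m = m' := by
  obtain ⟨-, ht, -⟩ := threadLength_spec hw hu
  obtain ⟨-, ht', -⟩ := threadLength_spec hw' hu'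
  induction m generalizing m' with
  | zero =>
    rcases m' with _ | m'
    · rw [zero_add, track_one, track_one] at h'
      exact ⟨h, h', rfl⟩
    · rw [track_zero] at h
      exact absurd (ht'.2 m' hm').1 (h ▸ hu)
  | succ m ih =>
    rcases m' with _ | m'
    · rw [track_zero] at h
      exact absurd (ht.2 m hm).1 (h ▸ hu')
    · have hback := (ht'.1 m' (by omega)).symm
      rw [← h] at hback
      rcases ht.eq_or_eq hm hback with he | he
      · obtain ⟨rfl, rfl, rfl⟩ := ih (by omega) (by omega) he.symm h
        exact ⟨rfl, rfl, rfl⟩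
      · exact absurd (he.trans h') (ht'.2 m' hm').2

lemma sum_threadLength_le {n : ℕ} {G : SimpleGraph (Fin n)} {adj : Fin n → List (Fin n)}
    (hadj : IsAdjLists G adj) :
    ∑ v with deg G v ≠ 2, ((adj v).map (threadLength G v)).sum ≤ ∑ v, deg G v := by
  have hdarts : ∑ v, deg G v = (Finset.univ.sigma fun v => (adj v).toFinset).card := by
    simp [Finset.card_sigma, List.toFinset_card_of_nodup (hadj _).1, deg_eq_length hadj]
  have hlength : ∑ v with deg G v ≠ 2, ((adj v).map (threadLength G v)).sum =
      ((Finset.univ.filter fun v => deg G v ≠ 2).sigma fun v =>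
        (adj v).toFinset.sigma fun w => Finset.range (threadLength G v w)).card := by
    simp [Finset.card_sigma, List.sum_toFinset _ (hadj _).1]
  rw [hdarts, hlength]
  refine Finset.card_le_card_of_injOn
    (fun d => ⟨track G d.1 d.2.1 d.2.2, track G d.1 d.2.1 (d.2.2 + 1)⟩) ?_ ?_
  · rintro ⟨v, w, m⟩ hd
    simp only [ne_eq, Finset.coe_sigma, Set.mem_sigma_iff, Finset.coe_filter, Finset.mem_univ,
      true_and, Set.mem_ofPred_eq, Finset.mem_coe, List.mem_toFinset, Finset.mem_range,
      (hadj _).2] at hd ⊢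
    exact (threadLength_spec hd.2.1 hd.1).2.1.1 m hd.2.2
  · rintro ⟨v, w, m⟩ hd ⟨v', w', m'⟩ hd' he
    simp only [ne_eq, Finset.coe_sigma, Set.mem_sigma_iff, Finset.coe_filter, Finset.mem_univ,
      true_and, Set.mem_ofPred_eq, Finset.mem_coe, List.mem_toFinset, Finset.mem_range,
      (hadj _).2] at hd hd'
    simp only [Sigma.mk.injEq, heq_eq_eq] at he
    obtain ⟨rfl, rfl, rfl⟩ :=
      track_pair_injective hd.1 hd'.1 hd.2.1 hd'.2.1 hd.2.2 hd'.2.2 he.1 he.2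
    rfl

lemma clawFree_iff_exists_triangle (hmax : ∀ v, deg G v ≤ 3) : ClawFree G ↔
    ∀ v, deg G v = 3 → ∃ a b, G.Adj v a ∧ G.Adj a b ∧ G.Adj v b := by
  refine ⟨fun hcf v hd => ?_, fun h v x y z hx hy hz hxy hyz hxz => ?_⟩
  · obtain ⟨a, b, -, -, -, ha, hb, hab, -⟩ := hcf.exists_triangle hd
    exact ⟨a, b, ha, hab, hb⟩
  · have hN (w) (hw : G.Adj v w) := eq_of_deg_le_three (hmax v) hx hy hz hxy hxz hyz hw
    have hd : deg G v = 3 := deg_eq_three_of_nbrs hxy hxz hyz fun w =>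
      ⟨hN w, by rintro (rfl | rfl | rfl) <;> assumption⟩
    obtain ⟨a, b, ha, hab, hb⟩ := h v hd
    have := hN a ha
    have := hN b hb
    have := hab.symm
    grind [SimpleGraph.irrefl]

end BadThreads

/-! ### Recognition of the class -/

section Recognition

variable {n : ℕ} {G : SimpleGraph (Fin n)} {adj : Fin n → List (Fin n)} {s s' : Mem}
  {u v w : Fin n} {m : ℕ}

/-- Let register `4` hold the number of vertices of degree more than `3`. -/
def countBigDegree : Prog :=
  countVertices (loadRange 3 10 ;; .succ 10 10 ;; .succ 10 10 ;; .succ 10 10 ;;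
    .ite (.lt 10 11) (.succ 4 4) skip)

lemma halts_countBigDegree (hadj : IsAdjLists G adj) (h : HasInput adj s) :
    Halts countBigDegree s (10 * n + 3) fun s' => s'.reg 4 = {v | 3 < deg G v}.ncard := by
  refine halts_countVertices_of_forall (W := {1, 4, 10, 11}) (b := 8) h (by decide) (by decide)
    fun v s hin hv => ?_
  refine .seq_of_frame (W := {10, 11}) (halts_loadRange (k := 10) hin hv (by decide))
    (by decide) fun s₁ hs₁ ⟨hstart, hend⟩ => .seq <| .succ <| .seq <| .succ <| .seq <| .succ <|
      .ite (T := 1) (T' := 1) (fun hlt => .succ ?_) fun hlt => .skip ?_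
  · have hd : 3 < deg G v := by
      simpa [hstart, hend, ← deg_eq_length hadj, add_assoc] using hlt
    simp [hs₁.reg_eq 4 (by decide), hd]
  · have hd : ¬ 3 < deg G v := by
      simpa [hstart, hend, ← deg_eq_length hadj, add_assoc] using hlt
    simp [hs₁.reg_eq 4 (by decide), hd]

/-- Add to register `5` the number of pairs of adjacent neighbors of the vertex in register `3`. -/
def countAdjNbrs : Prog :=
  forNbrs 3 13 (forNbrs 15 16 (forNbrs 3 19 (.ite (.eq 18 21) (.succ 5 5) skip)))

lemma halts_countAdjNbrs (hadj : IsAdjLists G adj) (hmax : ∀ v, deg G v ≤ 3)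
    (h : HasInput adj s) (hv : s.reg 3 = v) : Halts countAdjNbrs s 223 fun s' => s'.reg 5 =
      s.reg 5 + ((adj v).map fun a => ((adj a).map fun b =>
        ((adj v).map fun c => if b = c then 1 else 0).sum).sum).sum := by
  have hlen (v : Fin n) : (adj v).length ≤ 3 := deg_eq_length hadj v ▸ hmax v
  refine halts_forNbrs_of_length_le (W := {1, 5, 16, 17, 18, 19, 20, 21}) (k := 13) (f := 5)
    (P := forNbrs 15 16 (forNbrs 3 19 (.ite (.eq 18 21) (.succ 5 5) skip))) (b := 70) h hv
    (by decide) (by decide) (by decide) (by decide) (by decide) (hlen v) fun a _ s₁ hs₁ ha => ?_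
  have h₁ := h.of_agreeOff hs₁ (by decide)
  refine halts_forNbrs_of_length_le (W := {1, 5, 19, 20, 21}) (b := 19) h₁ ha
    (by decide) (by decide) (by decide) (by decide) (by decide) (hlen a) fun b _ s₂ hs₂ hb => ?_
  refine halts_forNbrs_of_length_le (W := {1, 5}) (b := 2) (h₁.of_agreeOff hs₂ (by decide))
    (by rw [hs₂.reg_eq 3 (by decide), hs₁.reg_eq 3 (by decide), hv])
    (by decide) (by decide) (by decide) (by decide) (by decide) (hlen v) fun c _ s₃ hs₃ hc => ?_
  have hb₃ : s₃.reg 18 = b := by rw [hs₃.reg_eq 18 (by decide), hb]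
  refine .ite (T := 1) (T' := 1) (fun hbc => .succ ?_) fun hbc => .skip ?_
  · simp [Fin.ext (hb₃.symm.trans (Eq.trans hbc hc))]
  · rw [holds_eq, hb₃, hc, Fin.val_inj] at hbc
    simp [hbc]

lemma halts_countClaws (hadj : IsAdjLists G adj) (hmax : ∀ v, deg G v ≤ 3)
    (h : HasInput adj s) : Halts (countCubic countAdjNbrs) s (248 * n + 3) fun s' =>
      s'.reg 4 = 0 ↔ ClawFree G := by
  refine (halts_countCubic hadj hmax h (by decide) fun v s hin hv =>
    halts_countAdjNbrs hadj hmax hin hv).mono fun s' hs' => ?_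
  rw [hs', Set.ncard_eq_zero, Set.eq_empty_iff_forall_notMem, clawFree_iff_exists_triangle hmax]
  refine forall_congr' fun v => ?_
  simp [List.sum_eq_zero_iff_forall_eq_nat, (hadj _).2]

/-- Let register `19` hold the neighbor other than the vertex in register `16` of the vertex of
degree `2` in register `17`. -/
def loadNext : Prog :=
  .load 21 0 17 ;; .load 19 1 21 ;; .ite (.eq 19 16) (.succ 21 21 ;; .load 19 1 21) skip

lemma halts_loadNext (hadj : IsAdjLists G adj) (h : HasInput adj s) (hu : s.reg 16 = u)
    (hv : s.reg 17 = v) (hd : deg G v = 2) (hvu : G.Adj v u) (hvw : G.Adj v w) (hwu : w ≠ u) :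
    Halts loadNext s 5 fun s' => s'.reg 19 = w := by
  have hlen : (adj v).length = 2 := by rw [← deg_eq_length hadj, hd]
  have hstart := h.arr_zero v.2.le
  have hfirst := h.arr_one v (k := 0) (by omega)
  have hsecond := h.arr_one v (k := 1) (by omega)
  have hN (k : ℕ) (hk : k < (adj v).length) : (adj v)[k] = u ∨ (adj v)[k] = w :=
    eq_or_eq_of_deg_le_two hd.le hvu hvw hwu.symm (((hadj v).2 _).1 (List.getElem_mem hk))
  have hne : (adj v)[0] ≠ (adj v)[1] := fun he => by
    simpa using (hadj v).1.getElem_inj_iff.1 he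
  rw [add_zero] at hfirst
  refine .seq <| .load <| .seq <| .load <| .ite (T := 2) (T' := 1)
    (fun he => .seq <| .succ <| .load ?_) fun he => .skip ?_
  · have he : (adj v)[0] = u := Fin.ext (by simpa [hu, hv, hstart, hfirst] using he)
    have hw : (adj v)[1] = w := (hN 1 (by omega)).resolve_left fun he' => hne (he.trans he'.symm)
    simp [hv, hstart, hsecond, hw]
  · have he : (adj v)[0] ≠ u := fun he' => he (by simp [hu, hv, hstart, hfirst, he'])
    simp [hv, hstart, hfirst, (hN 0 (by omega)).resolve_left he]

/-- The state after `m` steps of the walk along the thread that starts with `u`, `w`: the registers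
`16` and `17` hold two successive vertices, register `2` holds the degree of the second one, and
register `18` holds its distance from `u` along the thread modulo `3`. -/
structure OnThread (adj : Fin n → List (Fin n)) (G : SimpleGraph (Fin n)) (u w : Fin n) (m : ℕ)
    (s : Mem) : Prop where
  hasInput : HasInput adj s
  prev : s.reg 16 = track G u w m
  cur : s.reg 17 = track G u w (m + 1)
  deg_cur : s.reg 2 = deg G (track G u w (m + 1))
  length : s.reg 18 = (m + 1) % 3
  two : s.reg 20 = 2

/-- Add one modulo three to the number in register `x`. -/
def succModThree (x : ℕ) : Prog := ifEq x 2 (.const x 0) (.succ x x)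

lemma halts_succModThree {x : ℕ} (hx : x ≠ 1) (h : s.reg x = m % 3) :
    Halts (succModThree x) s 3 fun s' => s'.reg x = (m + 1) % 3 := by
  refine .ifEq (T := 1) (T' := 1) hx (fun h2 => .const ?_) fun h2 => .succ ?_
  · rw [reg_setReg, if_pos rfl]
    omega
  · simp only [reg_setReg, hx, ↓reduceIte]
    omega

/-- Take one step along a thread. -/
def stepThread : Prog :=
  loadNext ;; .copy 16 17 ;; .copy 17 19 ;; succModThree 18 ;; loadDeg 17

lemma halts_stepThread (hadj : IsAdjLists G adj) (hmax : ∀ v, deg G v ≤ 3)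
    (h : OnThread adj G u w m s) (hd : deg G (track G u w (m + 1)) = 2)
    (hback : G.Adj (track G u w (m + 1)) (track G u w m)) :
    Halts stepThread s 27 (OnThread adj G u w (m + 1)) := by
  obtain ⟨hne, hnext⟩ := track_add_two u w m hd
  refine .seq_of_frame (W := {1, 19, 21})
    (halts_loadNext hadj h.hasInput h.prev h.cur hd hback hnext hne) (by decide)
    fun s₁ hs₁ h19 => .seq <| .copy <| .seq <| .copy <| .seq_of_frame (W := {1, 18})
      (halts_succModThree (x := 18) (m := m + 1) (by decide) ?_) (T' := 17)
      (P' := loadDeg 17) (by decide) fun s₂ hs₂ h18 => ?_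
  · simp [hs₁.reg_eq 18 (by decide), h.length]
  · have hin := (((h.hasInput.of_agreeOff hs₁ (by decide)).setReg (x := 16) (by decide)
      _).setReg (x := 17) (by decide) _).of_agreeOff hs₂ (by decide)
    have hcur : s₂.reg 17 = track G u w (m + 2) := by simp [hs₂.reg_eq 17 (by decide), h19]
    refine ((halts_loadDeg hadj hin hcur (hmax _) (by decide)).frame (W := {2, 10, 11, 12})
      (by decide)).mono fun s₃ ⟨hs₃, h2⟩ => ⟨hin.of_agreeOff hs₃ (by decide), ?_, ?_, h2, ?_, ?_⟩
    · simp [hs₃.reg_eq 16 (by decide), hs₂.reg_eq 16 (by decide), hs₁.reg_eq 17 (by decide), h.cur]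
    · rw [hs₃.reg_eq 17 (by decide), hcur]
    · rw [hs₃.reg_eq 18 (by decide), h18]
    · simp [hs₃.reg_eq 20 (by decide), hs₂.reg_eq 20 (by decide), hs₁.reg_eq 20 (by decide), h.two]

/-- Walk along the thread that starts with the vertices in the registers `3` and `15`. -/
def walkThread : Prog :=
  .copy 16 3 ;; .copy 17 15 ;; .const 18 1 ;; .const 20 2 ;; loadDeg 17 ;;
    .loop (.eq 2 20) stepThread

lemma halts_walkThread (hadj : IsAdjLists G adj) (hmax : ∀ v, deg G v ≤ 3) (h : HasInput adj s)
    (hu : s.reg 3 = u) (hw : s.reg 15 = w) (hd : deg G u ≠ 2) (huw : G.Adj u w) :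
    Halts walkThread s (28 * threadLength G u w - 6) fun s' => s'.reg 17 = tip G u w ∧
      s'.reg 2 = deg G (tip G u w) ∧ s'.reg 18 = threadLength G u w % 3 := by
  obtain ⟨hpos, ht, hend⟩ := threadLength_spec huw hd
  rw [tip] at hend ⊢
  obtain ⟨k, hk⟩ := Nat.exists_eq_succ_of_ne_zero hpos.ne'
  rw [hk] at ht hend ⊢
  have hloop (s' : Mem) (hs' : OnThread adj G u w 0 s') := Halts.loop (b := .eq 2 20)
    (fun (m : Fin k) s₁ (hs₁ : OnThread adj G u w m s₁) =>
      have hd := (ht.2 m (by omega)).1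
      ⟨by rw [holds_eq, hs₁.deg_cur, hs₁.two, hd],
        halts_stepThread hadj hmax hs₁ hd (ht.1 m (by omega)).symm⟩)
    (fun s₁ hs₁ => by rwa [holds_eq, hs₁.deg_cur, hs₁.two]) hs'
  refine .of_le ?_ <| .seq <| .copy <| .seq <| .copy <| .seq <| .const <| .seq <| .const <|
    .seq_of_frame (W := {2, 10, 11, 12})
      (halts_loadDeg hadj (v := w) ⟨h.arr_eq, by simp [h.reg_zero]⟩ (by simp [hw]) (hmax w)
        (by decide)) (by decide) fun s₁ hs₁ h2 => (hloop s₁ ?_).mono fun s' hs' =>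
          ⟨hs'.cur, hs'.deg_cur, hs'.length⟩
  · simp only [Finset.sum_const, Finset.card_univ, Fintype.card_fin, smul_eq_mul]
    omega
  · exact ⟨⟨hs₁.arr_eq.trans h.arr_eq, by simp [hs₁.reg_eq 0 (by decide), h.reg_zero]⟩,
      by simp [hs₁.reg_eq 16 (by decide), hu, track_zero],
      by simp [hs₁.reg_eq 17 (by decide), hw, track_one],
      by rw [h2, zero_add, track_one], by simp [hs₁.reg_eq 18 (by decide)],
      by simp [hs₁.reg_eq 20 (by decide)]⟩

/-- Increment register `4` if the thread that starts with the vertices in the registers `3` and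
`15` is bad. -/
def countBadThread : Prog :=
  walkThread ;; ifEq 2 3 (ifEq 18 0 (.ite (.eq 17 3) skip (.succ 4 4)) skip) skip

open Classical in
lemma halts_countBadThread (hadj : IsAdjLists G adj) (hmax : ∀ v, deg G v ≤ 3)
    (h : HasInput adj s) (hu : s.reg 3 = u) (hw : s.reg 15 = w) (hd : deg G u ≠ 2)
    (huw : G.Adj u w) : Halts countBadThread s (28 * threadLength G u w) fun s' =>
      s'.reg 4 = s.reg 4 + if BadThread G u w then 1 else 0 := by
  have hpos := (threadLength_spec huw hd).1
  refine .of_le ?_ <| .seq_of_frame (W := {1, 2, 10, 11, 12, 16, 17, 18, 19, 20, 21})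
    (halts_walkThread hadj hmax h hu hw hd huw) (by decide)
    fun s₁ hs₁ ⟨htip, hdeg, hlen⟩ => .ifEq (T := 4) (T' := 1) (by decide)
      (fun h2 => .ifEq (T := 2) (T' := 1) (by decide)
        (fun h18 => .ite (T := 1) (T' := 1) (fun h17 => .skip ?_) fun h17 => .succ ?_)
        fun h18 => .skip ?_) fun h2 => .skip ?_
  · omega
  · have hbad : ¬ BadThread G u w := fun hb => hb.2.2 <| Fin.ext <| by
      simpa [htip, hs₁.reg_eq 3 (by decide), hu] using h17
    simp [hs₁.reg_eq 4 (by decide), hbad]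
  · have hbad : BadThread G u w := ⟨hdeg ▸ h2, by simpa [hlen] using h18, fun he => h17 <| by
      simp [htip, hs₁.reg_eq 3 (by decide), hu, he]⟩
    simp [hs₁.reg_eq 4 (by decide), hbad]
  · have hbad : ¬ BadThread G u w := fun hb => h18 (by simpa [hlen] using hb.2.1)
    simp [hs₁.reg_eq 4 (by decide), hbad]
  · have hbad : ¬ BadThread G u w := fun hb => h2 (hdeg.trans hb.1)
    simp [hs₁.reg_eq 4 (by decide), hbad]

open Classical in
lemma halts_forNbrs_countBadThread (hadj : IsAdjLists G adj) (hmax : ∀ v, deg G v ≤ 3)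
    (h : HasInput adj s) (hv : s.reg 3 = v) (hd : deg G v ≠ 2) :
    Halts (forNbrs 3 13 countBadThread) s (31 * ((adj v).map (threadLength G v)).sum + 4)
      fun s' => s'.reg 4 =
        s.reg 4 + ((adj v).map fun w => if BadThread G v w then 1 else 0).sum := by
  refine .of_le (Nat.add_le_add_right ?_ 4) <| halts_forNbrs
    (W := {1, 2, 4, 10, 11, 12, 16, 17, 18, 19, 20, 21}) (k := 13) (f := 4) (P := countBadThread)
    (B := fun w => 28 * threadLength G v w) h hv (by decide) (by decide) (by decide) (by decide)
    (by decide) fun w hw s' hs' hw' => halts_countBadThread hadj hmax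
      (h.of_agreeOff hs' (by decide)) (by rw [hs'.reg_eq 3 (by decide), hv]) hw' hd
      (((hadj v).2 w).1 hw)
  rw [← List.sum_map_mul_left]
  refine List.sum_le_sum fun w hw => ?_
  have := (threadLength_spec (((hadj v).2 w).1 hw) hd).1
  omega

/-- Let register `4` hold the number of bad threads. -/
def countBadThreads : Prog :=
  countVertices (loadDeg 3 ;; ifEq 2 3 (forNbrs 3 13 countBadThread) skip)

open Classical in
lemma halts_countBadThreads (hadj : IsAdjLists G adj) (hmax : ∀ v, deg G v ≤ 3)
    (h : HasInput adj s) : Halts countBadThreads s (121 * n + 3) fun s' =>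
      s'.reg 4 = 0 ↔ ∀ u w, deg G u = 3 → G.Adj u w → ¬ BadThread G u w := by
  let work (v : Fin n) : ℕ := if deg G v ≠ 2 then ((adj v).map (threadLength G v)).sum else 0
  let bad (v : Fin n) : ℕ :=
    if deg G v = 3 then ((adj v).map fun w => if BadThread G v w then 1 else 0).sum else 0
  have hwork : ∑ v, work v ≤ 3 * n := calc
    ∑ v, work v ≤ ∑ v, deg G v := by
      rw [← Finset.sum_filter]
      exact sum_threadLength_le hadj
    _ ≤ 3 * n := (Finset.sum_le_card_nsmul _ _ 3 fun v _ => hmax v).trans (by simp [mul_comm])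
  have hbody (v : Fin n) (s : Mem) (hin : HasInput adj s) (hv : s.reg 3 = v) :
      Halts (loadDeg 3 ;; ifEq 2 3 (forNbrs 3 13 countBadThread) skip) s (31 * work v + 26)
        fun s' => s'.reg 4 = s.reg 4 + bad v := by
    refine .of_le ?_ <| .seq_of_frame (W := {2, 10, 11, 12})
      (halts_loadDeg hadj hin hv (hmax v) (by decide)) (by decide) fun s₁ hs₁ hdeg =>
      .ifEq (x := 2) (T := 31 * work v + 4) (T' := 1) (by decide) (fun h2 => ?_)
        fun h2 => .skip ?_
    · omega
    · have hd : deg G v = 3 := hdeg ▸ h2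
      simpa [work, bad, hd, hs₁.reg_eq 4 (by decide)] using
        halts_forNbrs_countBadThread hadj hmax
          ((hin.of_agreeOff hs₁ (by decide)).setReg (x := 1) (by decide) 3)
          (by simp [hs₁.reg_eq 3 (by decide), hv]) (by omega)
    · simp [bad, ← hdeg, h2, hs₁.reg_eq 4 (by decide)]
  refine ((halts_countVertices (W := insert 1 (insert 2 (Finset.Icc 4 21))) h (by decide)
    (by decide) hbody).of_le ?_).mono fun s' hs' => ?_
  · rw [Finset.sum_add_distrib, Finset.sum_add_distrib, ← Finset.mul_sum]
    simp only [Finset.sum_const, Finset.card_univ, Fintype.card_fin, smul_eq_mul]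
    omega
  · simp only [hs', bad, Finset.sum_eq_zero_iff, Finset.mem_univ, true_imp_iff]
    refine forall_congr' fun u => ?_
    by_cases hd : deg G u = 3 <;> simp [hd, List.sum_eq_zero_iff_forall_eq_nat, (hadj u).2]

/-- Decide membership in the class `𝒞`. -/
def recognize : Prog :=
  countBigDegree ;; ifEq 4 0
    (countCubic countAdjNbrs ;; ifEq 4 0
      (countBadThreads ;; ifEq 4 0 (.const 0 1) (.const 0 0))
      (.const 0 0))
    (.const 0 0)

lemma decides_recognize (hadj : IsAdjLists G adj) (h : HasInput adj s) :
    Decides recognize s (379 * n + 18) (InC G) := by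
  have hbig : {v | 3 < deg G v}.ncard = 0 ↔ ∀ v, deg G v ≤ 3 := by
    rw [Set.ncard_eq_zero, Set.eq_empty_iff_forall_notMem]
    simp
  rw [inC_iff]
  refine .of_le ?_ <| decides_ifEq (T := 248 * n + 3 + (121 * n + 6 + 2)) (T' := 1) h
    (W := {1, 4, 3, 10, 11}) (by decide) (by decide)
    ((halts_countBigDegree hadj h).mono fun _ hc => by rw [hc, hbig])
    (fun hmax s₁ h₁ => ?_) fun hq _ _ => decides_false fun hC => hq hC.1
  · omega
  refine .of_le ?_ <| decides_ifEq (T := 121 * n + 3 + 3) (T' := 1) h₁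
    (W := insert 1 (insert 2 (Finset.Icc 3 21))) (by decide) (by decide)
    (halts_countClaws hadj hmax h₁)
    (fun hclaw s₂ h₂ => ?_) fun hq _ _ => decides_false fun hC => hq hC.2.1
  · omega
  exact decides_ifEq (T := 1) (T' := 1) h₂
    (W := insert 1 (insert 2 (Finset.Icc 3 21))) (by decide) (by decide)
    (halts_countBadThreads hadj hmax h₂) (fun hbad _ _ => decides_true ⟨hmax, hclaw, hbad⟩)
    fun hq _ _ => decides_false fun hC => hq hC.2.2

theorem recognize_decides :
    DecidesInLinearTime recognize (fun _ _ => True) (fun _ G => InC G) :=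
  ⟨397, fun _ hn _ _ hadj _ => (decides_recognize hadj ⟨rfl, rfl⟩).of_le (by omega)⟩

end Recognition

end DynCol

/-- 1. `𝒞` is recognized in linear time. 2. For connected graphs in `𝒞`, dynamic 3-colorability is
decided in linear time. 3. For these graphs the answer of the determination algorithm is computed
in linear time, and 4. it is correct unless the graph is a cycle (a connected graph all of whose
vertices have degree 2). -/
theorem mainTheorem7 :
    (∃ P : DynCol.Prog,
      DynCol.DecidesInLinearTime P (fun _ _ => True) (fun _ G => DynCol.InC G)) ∧
    (∃ P : DynCol.Prog,
      DynCol.DecidesInLinearTime P (fun _ G => G.Connected ∧ DynCol.InC G)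
        (fun _ G => DynCol.DynThreeColorable G)) ∧
    (∃ P : DynCol.Prog,
      DynCol.DecidesInLinearTime P (fun _ G => G.Connected ∧ DynCol.InC G)
        (fun _ G => DynCol.DeterminationAnswer G)) ∧
    (∀ (n : ℕ) (G : SimpleGraph (Fin n)), G.Connected → DynCol.InC G →
      ¬ (∀ v, DynCol.deg G v = 2) →
      (DynCol.DynThreeColorable G ↔ DynCol.DeterminationAnswer G)) := by
  refine ⟨⟨_, DynCol.recognize_decides⟩, ⟨_, DynCol.decideColorable_decides⟩,
    ⟨_, DynCol.determine_decides⟩, fun n G hconn hG h2 => ?_⟩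
  exact DynCol.dynThreeColorable_iff_determinationAnswer hconn hG h2
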